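/- Identify $su(2)$ with $\mathbb R^3$ through the basis $\mathbf e_j=\frac1{2i}\sigma_j$ ($\sigma_j$ the Pauli matrices), so that the commutator $[\cdot,\cdot]$ is the vector product and $\langle\eta,\zeta\rangle=-2\,\mathrm{tr}(\eta\zeta)$ is the Euclidean scalar product. For $W\in SU(2)$ let $\Im(W)=W-\frac12\mathrm{tr}(W)\mathbf 1\in su(2)$. Let $\alpha,\varepsilon\in\mathbb R\setminus\{0\}$, let $A\in su(2)$ with $\langle A,A\rangle=1$, and let $p\in su(2)$. On pairs $(g,\hat g)\in SU(2)\times SU(2)$ with $\mathrm{tr}(g^{-1}\hat g)>0$ consider the discrete Lagrange function $$\mathbb L(g,\hat g)=\Lambda(P,W)=-\frac{4\alpha}{\varepsilon}\log\mathrm{tr}(W)-\frac{2(1-\alpha)}{\varepsilon}\log\bigl(1+\langle A,W^{-1}AW\rangle\bigr)-\varepsilon\langle P,A\rangle,\qquad P=g^{-1}pg,\quad W=g^{-1}\hat g .$$ For $f:SU(2)\to\mathbb R$ let $d'f(g)\in su(2)$ be given by $\langle d'f(g),\eta\rangle=\frac{d}{ds}f(ge^{s\eta})|_{s=0}$ for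 all $\eta\in su(2)$. Put $$\xi_\varepsilon(M)=\frac{\varepsilon}{\alpha}M+\frac{2(1-\alpha)}{\alpha}\,\frac{[A,B]}{1+\langle A,B\rangle},\qquad B=(\mathbf 1+\varepsilon M)^{-1}A(\mathbf 1+\varepsilon M).$$ **Theorem 5.6.** 1. If $\mathrm{tr}(W)>0$, then $d'_W\Lambda(P,W)$ exists. Let $k_0\le k_1$ be integers, let $g_k\in SU(2)$ and $P_k,M_k\in su(2)$, and let $W_k=g_k^{-1}g_{k+1}$ for $k_0\le k<k_1$. The following are equivalent. (a) $P_k=g_k^{-1}pg_k$ for $k_0\le k\le k_1$; $\mathrm{tr}(W_k)>0$ and $M_{k+1}=d'_W\Lambda(P_k,W_k)$ for $k_0\le k<k_1$; and the discrete Euler–Lagrange equations $d'_1\mathbb L(g_k,g_{k+1})+d'_2\mathbb L(g_{k-1},g_k)=0$ hold for $k_0<k<k_1$. (b) $P_{k_0}=g_{k_0}^{-1}pg_{k_0}$; $$M_{k+1}=W_k^{-1}\bigl(M_k+\varepsilon[P_k,A]\bigr)W_k\ \ (k_0<k<k_1),\qquad P_{k+1}=W_k^{-1}P_kW_k\ \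 (k_0\le k<k_1);$$ and $W_k$ is determined by $M_{k+1}$ through $$\mathrm{tr}(W_k)>0,\qquad 2\,\frac{\Im(W_k)}{\mathrm{tr}(W_k)}=\xi_\varepsilon(M_{k+1})\qquad(k_0\le k<k_1).$$ 2. For every $M\in su(2)$ there is exactly one $W\in SU(2)$ with $\mathrm{tr}(W)>0$ and $2\Im(W)/\mathrm{tr}(W)=\xi$, where $\xi=\xi_\varepsilon(M)$, namely $W=\frac{\mathrm{tr}(W)}2(\mathbf 1+\xi)$ with $\mathrm{tr}(W)=2/\sqrt{1+\langle\xi,\xi\rangle/4}$. As $\varepsilon\to0$, uniformly on bounded sets of $M$, $$\xi_\varepsilon(M)=\varepsilon\Bigl(\frac1\alpha M+\frac{1-\alpha}{\alpha}[A,[A,M]]\Bigr)+O(\varepsilon^2).$$ 3. The equations $M'=W^{-1}(M+\varepsilon[P,A])W$, $P'=W^{-1}PW$, with $W$ determined by $M'$ as in 2, have for every $(M,P)\in su(2)\times su(2)$ exactly one solution $(M',P')$. The resulting map $\Phi:(M,P)\mapsto(M',P')$ is smooth and is Poisson for the Lie–Poisson bracket of $e(3)$, $\{M_i,M_j\}=\varepsilon_{ijk}M_k$,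 $\{M_i,P_j\}=\varepsilon_{ijk}P_k$, $\{P_i,P_j\}=0$. The functions $$\langle M,A\rangle,\qquad H_\varepsilon(M,P)=\tfrac12\langle M,M\rangle+\langle P,A\rangle+\tfrac\varepsilon2\langle[M,P],A\rangle$$ are integrals of $\Phi$ in involution, and $\Phi$ is completely integrable with them: on a dense open set the symplectic leaves have dimension $4$ and the Hamiltonian vector fields of the two functions are linearly independent. -/

import Mathlib

open scoped Matrix ContDiff

noncomputable section

namespace DiscreteTop

/-! ### `SU(2)`, `su(2)` and `ℝ³` -/

/-- The Lie group `SU(2)`. -/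
abbrev SU2 : Type := Matrix.specialUnitaryGroup (Fin 2) ℂ

/-- Coordinate vectors of elements of `su(2) ≅ ℝ³`. -/
abbrev Vec : Type := Fin 3 → ℝ

/-- The identification of `ℝ³` with `su(2)`,
`η ↦ η₁ 𝐞₁ + η₂ 𝐞₂ + η₃ 𝐞₃` with `𝐞ⱼ = σⱼ / (2i)`, `σⱼ` the Pauli matrices. -/
def hat (η : Vec) : Matrix (Fin 2) (Fin 2) ℂ :=
  (1 / 2 : ℂ) •
    !![-Complex.I * (η 2 : ℂ), -(η 1 : ℂ) - Complex.I * (η 0 : ℂ);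
       (η 1 : ℂ) - Complex.I * (η 0 : ℂ), Complex.I * (η 2 : ℂ)]

/-- The coordinate vector of the imaginary part `ℑ(X) ∈ su(2)` of a matrix of the form
`X = [[a + ib, c + id], [-c + id, a - ib]]`, where
`ℑ(X) = [[ib, c + id], [-c + id, -ib]]`. On `su(2)` itself this is the inverse of `hat`. -/
def vee (X : Matrix (Fin 2) (Fin 2) ℂ) : Vec :=
  ![-2 * (X 0 1).im, -2 * (X 0 1).re, -2 * (X 0 0).im]

theorem vee_hat (η : Vec) : vee (hat η) = η := by
  ext i
  fin_cases i <;> simp [vee, hat]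

theorem hat_vee {X : Matrix (Fin 2) (Fin 2) ℂ} (hX : Xᴴ = -X) (ht : X.trace = 0) :
    hat (vee X) = X := by
  have h00 := congrFun (congrFun hX 0) 0
  have h01 := congrFun (congrFun hX 0) 1
  have h10 := congrFun (congrFun hX 1) 0
  rw [Matrix.trace_fin_two] at ht
  simp only [Matrix.conjTranspose_apply, Matrix.neg_apply, Complex.ext_iff, Complex.neg_re,
    Complex.neg_im, RCLike.star_def, Complex.conj_re, Complex.conj_im] at h00 h01 h10
  simp only [Complex.ext_iff, Complex.add_re, Complex.add_im, Complex.zero_re,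
    Complex.zero_im] at ht
  ext i j
  fin_cases i <;> fin_cases j <;> simp [vee, hat, Complex.ext_iff] <;>
    (try constructor) <;> linarith [h00.1, h01.1, h01.2, h10.1, h10.2, ht.1, ht.2]

theorem hat_conjTranspose (η : Vec) : (hat η)ᴴ = -hat η := by
  ext i j
  fin_cases i <;> fin_cases j <;> simp [hat, Complex.ext_iff]

theorem trace_hat (η : Vec) : (hat η).trace = 0 := by
  simp [hat, Matrix.trace_fin_two]

/-- The commutator of `su(2)` is the vector product of `ℝ³`. -/
theorem hat_cross (u v : Vec) : hat (u ⨯₃ v) = hat u * hat v - hat v * hat u := by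
  ext i j
  fin_cases i <;> fin_cases j <;>
    simp [hat, cross_apply, Complex.ext_iff] <;>
    constructor <;> ring

/-- The scalar product of `ℝ³` in matrix form. -/
theorem dot_eq_trace (u v : Vec) :
    ((u ⬝ᵥ v : ℝ) : ℂ) = 2 * (hat u * (hat v)ᴴ).trace := by
  rw [hat_conjTranspose, Matrix.mul_neg, Matrix.trace_neg]
  simp [hat, dotProduct, Fin.sum_univ_three, Matrix.trace_fin_two, Complex.ext_iff]
  constructor <;> ring

theorem det_exp_hat_sq (η : Vec) : (NormedSpace.exp (hat η)).det ^ 2 = 1 := by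
  have hJ : IsUnit (!![0, 1; -1, 0] : Matrix (Fin 2) (Fin 2) ℂ) := by
    rw [Matrix.isUnit_iff_isUnit_det]
    simp [Matrix.det_fin_two]
  have hconj : (!![0, 1; -1, 0] : Matrix (Fin 2) (Fin 2) ℂ) * (hat η)ᵀ
      * (!![0, 1; -1, 0] : Matrix (Fin 2) (Fin 2) ℂ)⁻¹ = -hat η := by
    rw [Matrix.inv_def]
    ext i j
    fin_cases i <;> fin_cases j <;>
      simp [hat, Matrix.mul_apply, Fin.sum_univ_two, Matrix.det_fin_two,
        Matrix.adjugate_fin_two, Matrix.vecMul, dotProduct]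
  have h1 := Matrix.exp_conj (𝔸 := ℂ) _ (hat η)ᵀ hJ
  rw [hconj, Matrix.exp_neg, Matrix.exp_transpose] at h1
  have h2 := congrArg Matrix.det h1
  have hJd : IsUnit (!![0, 1; -1, 0] : Matrix (Fin 2) (Fin 2) ℂ).det := by
    simp [Matrix.det_fin_two]
  rw [Matrix.det_conj hJ, Matrix.det_transpose, Matrix.det_nonsing_inv] at h2
  have h3 : IsUnit (NormedSpace.exp (hat η)).det :=
    (Matrix.isUnit_iff_isUnit_det _).1 (Matrix.isUnit_exp (hat η))
  have h4 := Ring.mul_inverse_cancel _ h3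
  rw [h2] at h4
  rw [sq, h4]

theorem exp_hat_mem (η : Vec) :
    NormedSpace.exp (hat η) ∈ Matrix.specialUnitaryGroup (Fin 2) ℂ := by
  rw [Matrix.mem_specialUnitaryGroup_iff]
  constructor
  · rw [Matrix.mem_unitaryGroup_iff, Matrix.star_eq_conjTranspose, ← Matrix.exp_conjTranspose,
      hat_conjTranspose, Matrix.exp_neg]
    exact Matrix.mul_nonsing_inv _ ((Matrix.isUnit_iff_isUnit_det _).1
      (Matrix.isUnit_exp (hat η)))
  · have h : hat η = 2 • hat ((1 / 2 : ℝ) • η) := by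
      ext i j
      fin_cases i <;> fin_cases j <;> simp [hat] <;> ring
    rw [h, Matrix.exp_nsmul, Matrix.det_pow, det_exp_hat_sq]

/-- The exponential map `su(2) → SU(2)`. -/
def expSU (η : Vec) : SU2 := ⟨NormedSpace.exp (hat η), exp_hat_mem η⟩

/-- The (real) trace of an element of `SU(2)`. -/
def tr (g : SU2) : ℝ := (Matrix.trace (g : Matrix (Fin 2) (Fin 2) ℂ)).re

/-- The vector corresponding to `X⁻¹ v X ∈ su(2)`; it is used for `X ∈ SU(2)` and for
`X = 𝟏 + u`, `u ∈ su(2)`, where `X⁻¹ v X` does belong to `su(2)`, see `hat_conj_SU2` and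
`hat_conj_one_add`. -/
def conj (X : Matrix (Fin 2) (Fin 2) ℂ) (v : Vec) : Vec := vee (X⁻¹ * hat v * X)

theorem hat_conj_SU2 (g : SU2) (v : Vec) :
    hat (conj g v) = (g : Matrix (Fin 2) (Fin 2) ℂ)⁻¹ * hat v * g := by
  have hg := Matrix.mem_unitaryGroup_iff.1 (Matrix.mem_specialUnitaryGroup_iff.1 g.2).1
  have hinv : (g : Matrix (Fin 2) (Fin 2) ℂ)⁻¹ = (g : Matrix (Fin 2) (Fin 2) ℂ)ᴴ :=
    Matrix.inv_eq_right_inv hg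
  refine hat_vee ?_ ?_
  · rw [hinv]
    simp [Matrix.conjTranspose_mul, hat_conjTranspose, Matrix.mul_assoc]
  · rw [Matrix.trace_mul_comm, ← Matrix.mul_assoc, hinv]
    rw [Matrix.star_eq_conjTranspose] at hg
    rw [hg, Matrix.one_mul, trace_hat]

theorem one_add_hat_mul (u : Vec) :
    (1 + hat u) * (1 - hat u) = ((1 + u ⬝ᵥ u / 4 : ℝ) : ℂ) • 1 := by
  ext i j
  fin_cases i <;> fin_cases j <;>
    simp [hat, dotProduct, Fin.sum_univ_three, Matrix.mul_apply, Fin.sum_univ_two,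
      Complex.ext_iff] <;>
    constructor <;> ring

theorem inv_one_add_hat (u : Vec) :
    (1 + hat u)⁻¹ = (((1 + u ⬝ᵥ u / 4)⁻¹ : ℝ) : ℂ) • (1 - hat u) := by
  refine Matrix.inv_eq_right_inv ?_
  have hpos : (0 : ℝ) < 1 + u ⬝ᵥ u / 4 := by
    have : 0 ≤ u ⬝ᵥ u := by
      simp only [dotProduct, Fin.sum_univ_three]
      nlinarith [mul_self_nonneg (u 0), mul_self_nonneg (u 1), mul_self_nonneg (u 2)]
    linarith
  rw [Matrix.mul_smul, one_add_hat_mul, smul_smul, ← Complex.ofReal_mul,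
    inv_mul_cancel₀ hpos.ne', Complex.ofReal_one, one_smul]

theorem hat_conj_one_add (u v : Vec) :
    hat (conj (1 + hat u) v) = (1 + hat u)⁻¹ * hat v * (1 + hat u) := by
  refine hat_vee ?_ ?_
  · rw [inv_one_add_hat]
    ext i j
    fin_cases i <;> fin_cases j <;>
      simp [hat, Matrix.mul_apply, Fin.sum_univ_two, Complex.ext_iff] <;>
      constructor <;> ring
  · have h : IsUnit (1 + hat u).det := by
      have h1 := congrArg Matrix.det (inv_one_add_hat u)
      by_contra hc
      rw [Matrix.nonsing_inv_apply_not_isUnit _ hc] at h1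
      have h2 : (0 : Matrix (Fin 2) (Fin 2) ℂ) = (1 + hat u) * (1 + hat u)⁻¹ := by
        rw [Matrix.nonsing_inv_apply_not_isUnit _ hc, Matrix.mul_zero]
      have hpos : (0 : ℝ) < 1 + u ⬝ᵥ u / 4 := by
        have : 0 ≤ u ⬝ᵥ u := by
          simp only [dotProduct, Fin.sum_univ_three]
          nlinarith [mul_self_nonneg (u 0), mul_self_nonneg (u 1), mul_self_nonneg (u 2)]
        linarith
      rw [inv_one_add_hat, Matrix.mul_smul, one_add_hat_mul, smul_smul, ← Complex.ofReal_mul,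
        inv_mul_cancel₀ hpos.ne', Complex.ofReal_one, one_smul] at h2
      exact zero_ne_one h2
    rw [Matrix.trace_mul_comm, ← Matrix.mul_assoc, Matrix.mul_nonsing_inv _ h, Matrix.one_mul,
      trace_hat]

/-! ### The discrete Lagrangian and its Euler–Lagrange equations -/

/-- The reduced discrete Lagrange function `Λ⁽ˡ⁾(P, W)` of the Lagrange top (body frame). It is
meant on the domain `tr W > 0`, on which both logarithms have positive arguments when
`⟨A, A⟩ = 1`. -/
def lagr (α ε : ℝ) (A P : Vec) (W : SU2) : ℝ :=
  -(4 * α / ε) * Real.log (tr W)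
    - (2 * (1 - α) / ε) * Real.log (1 + A ⬝ᵥ conj W A)
    - ε * (P ⬝ᵥ A)

/-- The discrete Lagrange function `𝕃(g, ĝ) = Λ⁽ˡ⁾(P, W)` on `SU(2) × SU(2)`, where
`P = g⁻¹ p g` and `W = g⁻¹ ĝ`. -/
def discLagr (α ε : ℝ) (A p : Vec) (g g' : SU2) : ℝ :=
  lagr α ε A (conj g p) (g⁻¹ * g')

/-- `f` has at `g` the right Lie derivative `d'f(g) = ξ ∈ su(2)* ≅ su(2)`, i.e.
`d/ds f(g exp(sη)) = ⟨ξ, η⟩` at `s = 0` for all `η ∈ su(2)`. -/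
def HasLieDeriv (f : SU2 → ℝ) (g : SU2) (ξ : Vec) : Prop :=
  ∀ η : Vec, HasDerivAt (fun s : ℝ => f (g * expSU (s • η))) (ξ ⬝ᵥ η) 0

/-- The discrete Euler–Lagrange equation `∇₁𝕃(g₁, g₂) + ∇₂𝕃(g₀, g₁) = 0`, with the gradients
at `g₁` pulled back to the group unit. -/
def EulerLagrange (L : SU2 → SU2 → ℝ) (g₀ g₁ g₂ : SU2) : Prop :=
  ∃ ξ₁ ξ₂ : Vec, HasLieDeriv (fun x => L x g₂) g₁ ξ₁ ∧ HasLieDeriv (fun x => L g₀ x) g₁ ξ₂ ∧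
    ξ₁ + ξ₂ = 0

/-! ### The angular velocity and the map -/

/-- The vector `ξ = (ε/α) M + (2(1-α)/α) [A, B] / (1 + ⟨A, B⟩)`, where
`B = (𝟏 + εM)⁻¹ A (𝟏 + εM)`. -/
def xi (α ε : ℝ) (A M : Vec) : Vec :=
  (ε / α) • M +
    (2 * (1 - α) / α) • ((1 + A ⬝ᵥ conj (1 + hat (ε • M)) A)⁻¹ • (A ⨯₃ conj (1 + hat (ε • M)) A))

/-- `W` is an angular velocity belonging to the angular momentum `M`:
`tr W > 0` and `2 ℑ(W) / tr(W) = ξ`. -/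
def IsAngVel (α ε : ℝ) (A M : Vec) (W : SU2) : Prop :=
  0 < tr W ∧ (2 / tr W) • vee W = xi α ε A M

/-- The phase space with coordinates `z = (M, P)`. -/
abbrev Phase : Type := Vec × Vec

/-- `(M', P')` is obtained from `(M, P)` by one step of the discrete time Lagrange top. -/
def Step (α ε : ℝ) (A : Vec) (z z' : Phase) : Prop :=
  ∃ W : SU2, IsAngVel α ε A z'.1 W ∧
    z'.1 = conj W (z.1 + ε • (z.2 ⨯₃ A)) ∧ z'.2 = conj W z.2

/-! ### The bracket of `e(3)` and complete integrability -/

/-- The gradient `∇_M F`. -/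
def gradM (F : Phase → ℝ) (z : Phase) : Vec := fun i => fderiv ℝ F z (Pi.single i 1, 0)

/-- The gradient `∇_P F`. -/
def gradP (F : Phase → ℝ) (z : Phase) : Vec := fun i => fderiv ℝ F z (0, Pi.single i 1)

/-- The Lie–Poisson bracket of `e(3)`: the bracket with `{Mᵢ, Mⱼ} = εᵢⱼₖ Mₖ`,
`{Mᵢ, Pⱼ} = εᵢⱼₖ Pₖ`, `{Pᵢ, Pⱼ} = 0`. -/
def bracket (F G : Phase → ℝ) (z : Phase) : ℝ :=
  z.1 ⬝ᵥ (gradM F z ⨯₃ gradM G z) + z.2 ⬝ᵥ (gradM F z ⨯₃ gradP G z)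
    - z.2 ⬝ᵥ (gradM G z ⨯₃ gradP F z)

/-- The Hamiltonian vector field of `H`:
`Ṁ = [M, ∇_M H] + [P, ∇_P H]`, `Ṗ = [P, ∇_M H]`. -/
def hamField (H : Phase → ℝ) (z : Phase) : Phase :=
  (z.1 ⨯₃ gradM H z + z.2 ⨯₃ gradP H z, z.2 ⨯₃ gradM H z)

/-- The tangent space at `z` of the symplectic leaf through `z`, spanned by the values of the
Hamiltonian vector fields. -/
def leafTangent (z : Phase) : Submodule ℝ Phase :=
  Submodule.span ℝ {v | ∃ H : Phase → ℝ, ContDiff ℝ ∞ H ∧ v = hamField H z}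

/-- `Φ` is a Poisson map. -/
def IsPoissonMap (Φ : Phase → Phase) : Prop :=
  ContDiff ℝ ∞ Φ ∧ ∀ F G : Phase → ℝ, Differentiable ℝ F → Differentiable ℝ G →
    ∀ z, bracket (F ∘ Φ) (G ∘ Φ) z = bracket F G (Φ z)

/-- `Φ` is completely integrable (in the sense of Liouville and Arnold) with the integrals
`I₁, I₂`: it is Poisson, `I₁, I₂` are smooth integrals in involution, and on a dense open set
the symplectic leaves are of dimension `4 = 2 · 2` and `I₁, I₂` are functionally independent on
them, i.e. have linearly independent Hamiltonian vectors. -/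
structure IsCompletelyIntegrable (Φ : Phase → Phase) (I₁ I₂ : Phase → ℝ) : Prop where
  poisson : IsPoissonMap Φ
  smooth₁ : ContDiff ℝ ∞ I₁
  smooth₂ : ContDiff ℝ ∞ I₂
  integral₁ : ∀ z, I₁ (Φ z) = I₁ z
  integral₂ : ∀ z, I₂ (Φ z) = I₂ z
  involution : ∀ z, bracket I₁ I₂ z = 0
  independent : ∃ U : Set Phase, IsOpen U ∧ Dense U ∧ ∀ z ∈ U,
    Module.finrank ℝ (leafTangent z) = 4 ∧
      LinearIndependent ℝ ![hamField I₁ z, hamField I₂ z]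

/-- The integral `⟨M, A⟩`. -/
def axisMomentum (A : Vec) (z : Phase) : ℝ := z.1 ⬝ᵥ A

/-- The integral `H_ε = ½⟨M, M⟩ + ⟨P, A⟩ + (ε/2)⟨[M, P], A⟩`. -/
def energy (ε : ℝ) (A : Vec) (z : Phase) : ℝ :=
  (1 / 2) * (z.1 ⬝ᵥ z.1) + z.2 ⬝ᵥ A + (ε / 2) * ((z.1 ⨯₃ z.2) ⬝ᵥ A)

end DiscreteTop

end

open DiscreteTop

noncomputable section

namespace DiscreteTop

/-! Elements of `SU2` with positive trace are parametrized by vectors: `ofVec u` is `1 + hat u`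
divided by its norm, and its velocity `2 ℑ(W) / tr W` is `u` (`eq_ofVec_iff`). Conjugation becomes
the rational rotation `rot u`, and all the algebra takes place in `ℝ³`.

Differentiating the Lagrangian in `W` gives the Legendre transformation `momentum`, in which `P`
does not occur. Its inverse is `xi`: the tilt terms are orthogonal to `A`, so the `A`-component is
merely scaled, and what remains is linear algebra in the plane orthogonal to `A` (`xi_momentum`,
`momentum_xi`). The left derivative of the Lagrangian is `ε [P, A]` minus the momentum carried back
through `W`, so the Euler–Lagrange equation is the recursion for `M` (`eulerLagrange_iff`).

The step is implicit because `W` depends on the new momentum. Reversing the velocity solves it: with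
`K = M + ε [P, A]`, the equation for `M'` says that `-K` is the momentum of `-ξ`, so `ξ = -xi (-K)`
(`rot_momentum_neg`). This rotation factors into three Cayley rotations, one about `K` and two about
`A` (`ofVec_neg_xi_neg`). Since rotations about `A` preserve the `A`-component, the map is a
composition of `shift` and three maps `twist`. Each is Poisson; for a twist this reduces to a
Maurer–Cartan identity (`isPoissonMap_twist`).

Twists about `A` preserve both integrals; for the other two factors together, conservation of energy
is the Cayley identity `cayley_cross` paired with `A`. The leaves are the ranges of the Poisson
tensor, whose kernel is spanned by the two Casimir gradients when `P ≠ 0`; independence holds off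
the zero set of a nonzero quadratic form. -/

/-! ### Quaternion algebra of `hat` and the Cayley rotation. -/

theorem hat_add (u v : Vec) : hat (u + v) = hat u + hat v := by
  ext i j
  fin_cases i <;> fin_cases j <;> simp [hat, Complex.ext_iff] <;>
    (try constructor) <;> ring

theorem hat_smul (c : ℝ) (v : Vec) : hat (c • v) = (c : ℂ) • hat v := by
  ext i j
  fin_cases i <;> fin_cases j <;> simp [hat, Complex.ext_iff] <;>
    (try constructor) <;> ring

theorem hat_neg (v : Vec) : hat (-v) = -hat v := by
  have := hat_smul (-1) v
  simpa using this

theorem hat_injective : Function.Injective hat := Function.LeftInverse.injective vee_hat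

theorem hat_mul_hat (u v : Vec) :
    hat u * hat v = ((-(u ⬝ᵥ v / 4) : ℝ) : ℂ) • 1 + hat ((1 / 2 : ℝ) • (u ⨯₃ v)) := by
  ext i j
  fin_cases i <;> fin_cases j <;>
    simp [hat, cross_apply, dotProduct, Fin.sum_univ_three, Matrix.mul_apply, Fin.sum_univ_two,
      Complex.ext_iff] <;>
    (try constructor) <;> ring

theorem dot_self_nonneg (u : Vec) : 0 ≤ u ⬝ᵥ u := by
  simp only [dotProduct, Fin.sum_univ_three]
  nlinarith [mul_self_nonneg (u 0), mul_self_nonneg (u 1), mul_self_nonneg (u 2)]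

theorem one_add_dot_pos (u : Vec) : 0 < 1 + u ⬝ᵥ u / 4 := by
  linarith [dot_self_nonneg u]

/-- The rotation `v ↦ (𝟏 + u)⁻¹ v (𝟏 + u)`. -/
abbrev rot (u v : Vec) : Vec := conj (1 + hat u) v

theorem rot_eq (u v : Vec) :
    rot u v = (1 + u ⬝ᵥ u / 4)⁻¹ •
      ((1 - u ⬝ᵥ u / 4) • v + v ⨯₃ u + (1 / 2 * (u ⬝ᵥ v)) • u) := by
  rw [rot, conj, inv_one_add_hat, ← vee_hat ((1 + u ⬝ᵥ u / 4)⁻¹ • _), hat_smul, Matrix.smul_mul,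
    Matrix.smul_mul]
  congr 2
  ext i j
  fin_cases i <;> fin_cases j <;>
    simp [hat, Matrix.vecHead, Matrix.vecTail, cross_apply, dotProduct, Fin.sum_univ_three, Matrix.mul_apply, Fin.sum_univ_two,
      Complex.ext_iff] <;>
    constructor <;> ring

/-! ### Structure of `SU(2)` -/

theorem coe_inv (W : SU2) : ((W⁻¹ : SU2) : Matrix (Fin 2) (Fin 2) ℂ) =
    (W : Matrix (Fin 2) (Fin 2) ℂ)⁻¹ := by
  refine (Matrix.inv_eq_right_inv ?_).symm
  rw [← Submonoid.coe_mul, mul_inv_cancel, Submonoid.coe_one]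

theorem isUnit_coe (W : SU2) : IsUnit (W : Matrix (Fin 2) (Fin 2) ℂ).det := by
  rw [(Matrix.mem_specialUnitaryGroup_iff.1 W.2).2]
  exact isUnit_one

theorem coe_entries (W : SU2) : (W : Matrix (Fin 2) (Fin 2) ℂ) 1 1 = star (W.1 0 0) ∧
    (W : Matrix (Fin 2) (Fin 2) ℂ) 1 0 = - star (W.1 0 1) := by
  have hg := Matrix.mem_unitaryGroup_iff.1 (Matrix.mem_specialUnitaryGroup_iff.1 W.2).1
  have hinv : (W : Matrix (Fin 2) (Fin 2) ℂ)⁻¹ = (W : Matrix (Fin 2) (Fin 2) ℂ)ᴴ :=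
    Matrix.inv_eq_right_inv hg
  rw [Matrix.inv_def, (Matrix.mem_specialUnitaryGroup_iff.1 W.2).2, Matrix.adjugate_fin_two] at hinv
  have h00 := congrFun (congrFun hinv 0) 0
  have h10 := congrFun (congrFun hinv 1) 0
  simp at h00 h10
  exact ⟨h00, by simp [← h10]⟩

theorem coe_eq (W : SU2) : (W : Matrix (Fin 2) (Fin 2) ℂ) =
    ((tr W / 2 : ℝ) : ℂ) • 1 + hat (vee W) := by
  obtain ⟨h1, h2⟩ := coe_entries W
  ext i j
  fin_cases i <;> fin_cases j <;>
    simp [hat, tr, vee, Matrix.trace_fin_two, Complex.ext_iff, h1, h2]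

theorem tr_sq_add (W : SU2) : (tr W / 2) ^ 2 + vee W ⬝ᵥ vee W / 4 = 1 := by
  have h := (Matrix.mem_specialUnitaryGroup_iff.1 W.2).2
  obtain ⟨h1, h2⟩ := coe_entries W
  rw [Matrix.det_fin_two, h1, h2] at h
  have := congrArg Complex.re h
  simp [tr, vee, dotProduct, Fin.sum_univ_three, Matrix.trace_fin_two, h1] at this ⊢
  linarith

theorem ofVec_mem (u : Vec) :
    (((√(1 + u ⬝ᵥ u / 4))⁻¹ : ℝ) : ℂ) • (1 + hat u) ∈ Matrix.specialUnitaryGroup (Fin 2) ℂ := by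
  have hpos := one_add_dot_pos u
  have hs : ((√(1 + u ⬝ᵥ u / 4))⁻¹) * ((√(1 + u ⬝ᵥ u / 4))⁻¹) * (1 + u ⬝ᵥ u / 4) = 1 := by
    rw [← mul_inv, Real.mul_self_sqrt hpos.le, inv_mul_cancel₀ hpos.ne']
  rw [Matrix.mem_specialUnitaryGroup_iff, Matrix.mem_unitaryGroup_iff,
    Matrix.star_eq_conjTranspose, Matrix.conjTranspose_smul, Matrix.conjTranspose_add,
    hat_conjTranspose, Matrix.conjTranspose_one, ← sub_eq_add_neg, Matrix.smul_mul,
    Matrix.mul_smul, one_add_hat_mul, Matrix.det_smul]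
  constructor
  · rw [smul_smul, smul_smul, RCLike.star_def, Complex.conj_ofReal]
    rw [← Complex.ofReal_mul, ← Complex.ofReal_mul, hs, Complex.ofReal_one, one_smul]
  · have : (1 + hat u).det = ((1 + u ⬝ᵥ u / 4 : ℝ) : ℂ) := by
      simp [hat, Matrix.det_fin_two, dotProduct, Fin.sum_univ_three, Complex.ext_iff]
      constructor <;> ring
    rw [this, Fintype.card_fin, sq, ← Complex.ofReal_mul, ← Complex.ofReal_mul, hs,
      Complex.ofReal_one]

/-- The element of `SU(2)` positively proportional to `𝟏 + u`. -/
def ofVec (u : Vec) : SU2 := ⟨_, ofVec_mem u⟩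

theorem tr_ofVec (u : Vec) : tr (ofVec u) = 2 / √(1 + u ⬝ᵥ u / 4) := by
  simp [tr, ofVec, Matrix.trace_fin_two, hat, -Complex.ofReal_inv]
  ring

theorem tr_ofVec_pos (u : Vec) : 0 < tr (ofVec u) := by
  rw [tr_ofVec]
  exact div_pos two_pos (Real.sqrt_pos.2 (one_add_dot_pos u))

theorem vee_smul (c : ℝ) (X : Matrix (Fin 2) (Fin 2) ℂ) : vee ((c : ℂ) • X) = c • vee X := by
  ext i
  fin_cases i <;> simp [vee] <;> ring

theorem vee_one_add_hat (u : Vec) : vee (1 + hat u) = u := by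
  ext i
  fin_cases i <;> simp [vee, hat]

theorem velocity_ofVec (u : Vec) : (2 / tr (ofVec u)) • vee (ofVec u) = u := by
  have : 0 < √(1 + u ⬝ᵥ u / 4) := Real.sqrt_pos.2 (one_add_dot_pos u)
  rw [tr_ofVec, ofVec, vee_smul, vee_one_add_hat, smul_smul, div_div_cancel₀ two_ne_zero,
    mul_inv_cancel₀ this.ne', one_smul]

/-- The determinant condition `(tr W / 2)² + |vee W|² / 4 = 1` with `vee W = (tr W / 2) u` fixes the
square of the trace; positivity fixes its sign. -/
theorem tr_eq_of_velocity {W : SU2} {u : Vec} (hW : 0 < tr W) (hu : (2 / tr W) • vee W = u) :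
    tr W = 2 / √(1 + u ⬝ᵥ u / 4) := by
  have hv : vee W = (tr W / 2) • u := by
    rw [← hu, smul_smul]
    field_simp
    simp
  have h := tr_sq_add W
  rw [hv, smul_dotProduct, dotProduct_smul, smul_eq_mul, smul_eq_mul] at h
  have hp := one_add_dot_pos u
  have h2 : (2 / tr W) ^ 2 = 1 + u ⬝ᵥ u / 4 := by
    field_simp
    linarith
  rw [← h2, Real.sqrt_sq (by positivity)]
  field_simp

theorem coe_eq_of_velocity {W : SU2} {u : Vec} (hW : 0 < tr W) (hu : (2 / tr W) • vee W = u) :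
    (W : Matrix (Fin 2) (Fin 2) ℂ) = ((tr W / 2 : ℝ) : ℂ) • (1 + hat u) := by
  have hv : vee W = (tr W / 2) • u := by
    rw [← hu, smul_smul]
    field_simp
    simp
  conv_lhs => rw [coe_eq W, hv, hat_smul, ← smul_add]

theorem eq_ofVec_iff {W : SU2} {u : Vec} :
    (0 < tr W ∧ (2 / tr W) • vee W = u) ↔ W = ofVec u := by
  constructor
  · rintro ⟨h1, h2⟩
    apply Subtype.ext
    rw [coe_eq_of_velocity h1 h2, coe_eq_of_velocity (tr_ofVec_pos u) (velocity_ofVec u),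
      tr_eq_of_velocity h1 h2, tr_ofVec]
  · rintro rfl
    exact ⟨tr_ofVec_pos u, velocity_ofVec u⟩

/-! ### Conjugation -/

theorem inv_sqrt_mul_self (u : Vec) :
    (√(1 + u ⬝ᵥ u / 4))⁻¹ * (√(1 + u ⬝ᵥ u / 4))⁻¹ = (1 + u ⬝ᵥ u / 4)⁻¹ := by
  rw [← mul_inv, Real.mul_self_sqrt (one_add_dot_pos u).le]

theorem ofVec_neg (u : Vec) : ofVec (-u) = (ofVec u)⁻¹ := by
  refine eq_inv_of_mul_eq_one_right (Subtype.ext ?_)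
  rw [Submonoid.coe_mul, Submonoid.coe_one]
  simp only [ofVec, hat_neg, ← sub_eq_add_neg, Matrix.smul_mul, Matrix.mul_smul, one_add_hat_mul,
    smul_smul, neg_dotProduct, dotProduct_neg, neg_neg, ← Complex.ofReal_mul]
  rw [← mul_assoc, inv_sqrt_mul_self, inv_mul_cancel₀ (one_add_dot_pos u).ne', Complex.ofReal_one,
    one_smul]

theorem conj_ofVec (u v : Vec) : conj (ofVec u) v = rot u v := by
  rw [conj, rot, conj, ← coe_inv, ← ofVec_neg, inv_one_add_hat]
  simp only [ofVec, hat_neg, ← sub_eq_add_neg, Matrix.smul_mul, Matrix.mul_smul,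
    smul_smul, neg_dotProduct, dotProduct_neg, neg_neg, ← Complex.ofReal_mul, inv_sqrt_mul_self]

theorem conj_mul (g h : SU2) (v : Vec) : conj (g * h : SU2) v = conj h (conj g v) := by
  apply hat_injective
  rw [hat_conj_SU2, hat_conj_SU2, hat_conj_SU2, Submonoid.coe_mul, Matrix.mul_inv_rev]
  simp only [Matrix.mul_assoc]

theorem conj_one (v : Vec) : conj (1 : SU2) v = v := by
  apply hat_injective
  rw [hat_conj_SU2]
  simp

theorem conj_inv_conj (g : SU2) (v : Vec) : conj (g⁻¹ : SU2) (conj g v) = v := by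
  rw [← conj_mul, mul_inv_cancel, conj_one]

theorem conj_conj_inv (g : SU2) (v : Vec) : conj g (conj (g⁻¹ : SU2) v) = v := by
  rw [← conj_mul, inv_mul_cancel, conj_one]

theorem conj_add (g : SU2) (u v : Vec) : conj g (u + v) = conj g u + conj g v := by
  apply hat_injective
  simp only [hat_conj_SU2, hat_add, Matrix.mul_add, Matrix.add_mul]

theorem conj_smul (g : SU2) (c : ℝ) (v : Vec) : conj g (c • v) = c • conj g v := by
  apply hat_injective
  simp only [hat_conj_SU2, hat_smul, Matrix.mul_smul, Matrix.smul_mul]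

theorem conj_neg (g : SU2) (v : Vec) : conj g (-v) = -conj g v := by
  simpa using conj_smul g (-1) v

theorem conj_dot (g : SU2) (u v : Vec) : conj g u ⬝ᵥ conj g v = u ⬝ᵥ v := by
  rw [← Complex.ofReal_inj, dot_eq_trace, dot_eq_trace, hat_conjTranspose, hat_conjTranspose,
    hat_conj_SU2, hat_conj_SU2, Matrix.mul_neg, Matrix.mul_neg, Matrix.trace_neg, Matrix.trace_neg]
  congr 2
  have h := Matrix.mul_nonsing_inv _ (isUnit_coe g)
  rw [show (g : Matrix (Fin 2) (Fin 2) ℂ)⁻¹ * hat u * g * ((g : Matrix (Fin 2) (Fin 2) ℂ)⁻¹ * hat v * g)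
    = (g : Matrix (Fin 2) (Fin 2) ℂ)⁻¹ * (hat u * ((g : Matrix (Fin 2) (Fin 2) ℂ)
      * (g : Matrix (Fin 2) (Fin 2) ℂ)⁻¹) * hat v * g) by simp only [Matrix.mul_assoc],
    h, Matrix.trace_mul_comm, Matrix.mul_assoc, h]
  simp

theorem conj_cross (g : SU2) (u v : Vec) : conj g (u ⨯₃ v) = conj g u ⨯₃ conj g v := by
  apply hat_injective
  have h := Matrix.mul_nonsing_inv _ (isUnit_coe g)
  have key : ∀ u v, (g : Matrix (Fin 2) (Fin 2) ℂ)⁻¹ * hat u * g *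
      ((g : Matrix (Fin 2) (Fin 2) ℂ)⁻¹ * hat v * g)
      = (g : Matrix (Fin 2) (Fin 2) ℂ)⁻¹ * (hat u * hat v) * g := fun u v => by
    rw [show (g : Matrix (Fin 2) (Fin 2) ℂ)⁻¹ * hat u * g *
        ((g : Matrix (Fin 2) (Fin 2) ℂ)⁻¹ * hat v * g)
      = (g : Matrix (Fin 2) (Fin 2) ℂ)⁻¹ * (hat u * ((g : Matrix (Fin 2) (Fin 2) ℂ)
        * (g : Matrix (Fin 2) (Fin 2) ℂ)⁻¹) * hat v * g) by simp only [Matrix.mul_assoc], h]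
    simp only [Matrix.mul_assoc, Matrix.one_mul]
  rw [hat_cross, hat_conj_SU2, hat_conj_SU2, hat_conj_SU2, hat_cross, key, key, Matrix.mul_sub,
    Matrix.sub_mul]

theorem rot_add (w u v : Vec) : rot w (u + v) = rot w u + rot w v := by
  simp only [← conj_ofVec, conj_add]

theorem rot_smul (w : Vec) (c : ℝ) (v : Vec) : rot w (c • v) = c • rot w v := by
  simp only [← conj_ofVec, conj_smul]

theorem rot_dot (w u v : Vec) : rot w u ⬝ᵥ rot w v = u ⬝ᵥ v := by
  simp only [← conj_ofVec, conj_dot]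

theorem rot_cross (w u v : Vec) : rot w (u ⨯₃ v) = rot w u ⨯₃ rot w v := by
  simp only [← conj_ofVec, conj_cross]

theorem rot_neg_rot (u v : Vec) : rot (-u) (rot u v) = v := by
  rw [← conj_ofVec, ← conj_ofVec, ofVec_neg, conj_inv_conj]

theorem rot_rot_neg (u v : Vec) : rot u (rot (-u) v) = v := by
  rw [← conj_ofVec, ← conj_ofVec, ofVec_neg, conj_conj_inv]

theorem rot_smul_self (u : Vec) (c : ℝ) : rot (c • u) u = u := by
  rw [rot_eq]
  have := one_add_dot_pos (c • u)
  rw [inv_smul_eq_iff₀ this.ne']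
  simp only [smul_dotProduct, dotProduct_smul, smul_eq_mul, map_smul, cross_self, smul_zero]
  module

/-! ### The Legendre transformation -/

theorem cross_cross_self (A u : Vec) : A ⨯₃ (A ⨯₃ u) = (A ⬝ᵥ u) • A - (A ⬝ᵥ A) • u := by
  ext i
  fin_cases i <;> simp [cross_apply, dotProduct, Fin.sum_univ_three] <;> ring

/-- The vector `[A, B] / (1 + ⟨A, B⟩)` with `B = (𝟏 + u)⁻¹ A (𝟏 + u)`. -/
def tilt (A u : Vec) : Vec := (1 + A ⬝ᵥ rot u A)⁻¹ • (A ⨯₃ rot u A)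

theorem one_add_dot_rot {A : Vec} (hA : A ⬝ᵥ A = 1) (u : Vec) :
    1 + A ⬝ᵥ rot u A = (1 + u ⬝ᵥ u / 4)⁻¹ * (2 * (1 + (A ⬝ᵥ u) ^ 2 / 4)) := by
  have := one_add_dot_pos u
  rw [rot_eq]
  simp only [dotProduct_smul, dotProduct_add, dot_self_cross, hA, smul_eq_mul, dotProduct_comm u A]
  have h : 0 < 4 + u ⬝ᵥ u := by linarith
  field_simp
  ring

theorem one_add_dot_rot_pos {A : Vec} (hA : A ⬝ᵥ A = 1) (u : Vec) : 0 < 1 + A ⬝ᵥ rot u A := by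
  rw [one_add_dot_rot hA]
  have := one_add_dot_pos u
  positivity

/-- The factor `1 + |u|² / 4` cancels between numerator and denominator, so the only nonlinearity
left is in the scalar `A ⬝ᵥ u`. This is what makes the Legendre transformation explicitly
invertible. -/
theorem tilt_eq {A : Vec} (hA : A ⬝ᵥ A = 1) (u : Vec) :
    tilt A u = (2 * (1 + (A ⬝ᵥ u) ^ 2 / 4))⁻¹ •
      ((A ⬝ᵥ u) • A - u + (A ⬝ᵥ u / 2) • (A ⨯₃ u)) := by
  have h1 := one_add_dot_pos u
  have h2 : A ⨯₃ (A ⨯₃ u) = (A ⬝ᵥ u) • A - u := by rw [cross_cross_self, hA, one_smul]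
  rw [tilt, one_add_dot_rot hA, rot_eq, ← h2, mul_inv_rev, inv_inv]
  simp only [map_smul, map_add, cross_self, smul_zero, zero_add, smul_smul, dotProduct_comm u A,
    mul_assoc, mul_inv_cancel₀ h1.ne', mul_one]
  congr 2
  ring_nf

theorem dot_tilt (A u : Vec) : A ⬝ᵥ tilt A u = 0 := by
  rw [tilt, dotProduct_smul, dot_self_cross, smul_zero]

theorem cross_tilt {A : Vec} (hA : A ⬝ᵥ A = 1) (u : Vec) :
    A ⨯₃ tilt A u = (2 * (1 + (A ⬝ᵥ u) ^ 2 / 4))⁻¹ •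
      (-(A ⨯₃ u) + (A ⬝ᵥ u / 2) • ((A ⬝ᵥ u) • A - u)) := by
  rw [tilt_eq hA]
  simp only [map_smul, map_add, map_sub, cross_self, cross_cross_self, hA, one_smul, smul_zero,
    zero_sub]

theorem xi_eq_tilt (α ε : ℝ) (A M : Vec) :
    xi α ε A M = (1 / α) • (ε • M) + (2 * (1 - α) / α) • tilt A (ε • M) := by
  rw [xi, tilt, smul_smul (1 / α), one_div_mul_eq_div]

/-- The momentum belonging to the velocity `ξ`. -/
def momentum (α ε : ℝ) (A ξ : Vec) : Vec :=
  (α / ε) • ξ - (2 * (1 - α) / ε) • tilt A ξ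

theorem smul_momentum {α ε : ℝ} (hε : ε ≠ 0) (A ξ : Vec) :
    ε • momentum α ε A ξ = α • ξ - (2 * (1 - α)) • tilt A ξ := by
  rw [momentum, smul_sub, smul_smul, smul_smul, mul_div_cancel₀ _ hε, mul_div_cancel₀ _ hε]

theorem xi_momentum {α ε : ℝ} (hα : α ≠ 0) (hε : ε ≠ 0) {A : Vec} (hA : A ⬝ᵥ A = 1) (ξ : Vec) :
    xi α ε A (momentum α ε A ξ) = ξ := by
  -- The outer tilt sees its argument only through its `A`-component, its cross product with `A` and
  -- linearly. All are combinations of `A`, `ξ` and `A ⨯₃ ξ`, so the identity becomes one of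
  -- rational functions, checked coordinatewise.
  have hd : A ⬝ᵥ (α • ξ - (2 * (1 - α)) • tilt A ξ) = α * (A ⬝ᵥ ξ) := by
    rw [dotProduct_sub, dotProduct_smul, dotProduct_smul, dot_tilt]
    simp
  have hc : A ⨯₃ (α • ξ - (2 * (1 - α)) • tilt A ξ) =
      α • (A ⨯₃ ξ) - (2 * (1 - α)) • (A ⨯₃ tilt A ξ) := by
    simp only [map_sub, map_smul]
  rw [xi_eq_tilt, smul_momentum hε, tilt_eq hA (_ - _), hd, hc, cross_tilt hA, tilt_eq hA]
  generalize A ⨯₃ ξ = Y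
  generalize A ⬝ᵥ ξ = x
  ext i
  simp only [Pi.add_apply, Pi.sub_apply, Pi.smul_apply, smul_eq_mul, Pi.neg_apply]
  have h1 : 0 < 4 + x ^ 2 := by positivity
  have h2 : 0 < 4 + α ^ 2 * x ^ 2 := by positivity
  field_simp
  ring

theorem momentum_xi {α ε : ℝ} (hα : α ≠ 0) (hε : ε ≠ 0) {A : Vec} (hA : A ⬝ᵥ A = 1) (M : Vec) :
    momentum α ε A (xi α ε A M) = M := by
  rw [← (smul_right_injective Vec hε).eq_iff]
  simp only [smul_momentum hε, xi_eq_tilt]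
  generalize ε • M = u
  have hd : A ⬝ᵥ ((1 / α) • u + (2 * (1 - α) / α) • tilt A u) = 1 / α * (A ⬝ᵥ u) := by
    rw [dotProduct_add, dotProduct_smul, dotProduct_smul, dot_tilt]
    simp
  have hc : A ⨯₃ ((1 / α) • u + (2 * (1 - α) / α) • tilt A u) =
      (1 / α) • (A ⨯₃ u) + (2 * (1 - α) / α) • (A ⨯₃ tilt A u) := by
    simp only [map_add, map_smul]
  rw [tilt_eq hA (_ + _), hd, hc, cross_tilt hA, tilt_eq hA]
  generalize A ⨯₃ u = Y
  generalize A ⬝ᵥ u = x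
  ext i
  simp only [Pi.add_apply, Pi.sub_apply, Pi.smul_apply, smul_eq_mul, Pi.neg_apply]
  have h1 : 0 < 4 + x ^ 2 := by positivity
  have h2 : 0 < 4 * α ^ 2 + x ^ 2 := by positivity
  field_simp
  ring

/-! ### Solving the implicit step by velocity reversal, and factorizing the solution. -/

/-- `rot ξ` carries the pair `A`, `rot (-ξ) A` to `rot ξ A`, `A`: the denominator is unchanged and
the cross product changes sign. -/
theorem rot_tilt_neg (A ξ : Vec) : rot ξ (tilt A (-ξ)) = -tilt A ξ := by
  rw [tilt, tilt, rot_smul, rot_cross, rot_rot_neg, ← rot_dot ξ A, rot_rot_neg, dotProduct_comm,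
    ← cross_anticomm, smul_neg]

theorem rot_momentum_neg (α ε : ℝ) (A ξ : Vec) :
    rot ξ (-momentum α ε A (-ξ)) = momentum α ε A ξ := by
  have hs : rot ξ ξ = ξ := by simpa using rot_smul_self ξ 1
  have h : -momentum α ε A (-ξ) = (α / ε) • ξ + (2 * (1 - α) / ε) • tilt A (-ξ) := by
    rw [momentum]
    module
  rw [h, rot_add, rot_smul, rot_smul, hs, rot_tilt_neg, momentum]
  module

theorem eq_momentum_iff {α ε : ℝ} (hα : α ≠ 0) (hε : ε ≠ 0) {A : Vec} (hA : A ⬝ᵥ A = 1)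
    (M ξ : Vec) : M = momentum α ε A ξ ↔ ξ = xi α ε A M :=
  ⟨fun h => by rw [h, xi_momentum hα hε hA], fun h => by rw [h, momentum_xi hα hε hA]⟩

/-- Uniqueness for the implicit step: any solution `M` has a velocity that is an explicit function
of the known vector `K`. The next lemma is the existence half. -/
theorem xi_eq_neg_xi_neg {α ε : ℝ} (hα : α ≠ 0) (hε : ε ≠ 0) {A : Vec} (hA : A ⬝ᵥ A = 1)
    {K M : Vec} (h : M = rot (xi α ε A M) K) : xi α ε A M = -xi α ε A (-K) := by
  have hK : K = -momentum α ε A (-xi α ε A M) := by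
    rw [← rot_neg_rot (xi α ε A M) K, ← h]
    nth_rw 2 [← momentum_xi hα hε hA M]
    rw [← rot_momentum_neg, rot_neg_rot]
  rw [← neg_eq_iff_eq_neg, ← eq_momentum_iff hα hε hA, neg_eq_iff_eq_neg]
  exact hK

theorem xi_rot_neg_xi_neg {α ε : ℝ} (hα : α ≠ 0) (hε : ε ≠ 0) {A : Vec} (hA : A ⬝ᵥ A = 1)
    (K : Vec) : xi α ε A (rot (-xi α ε A (-K)) K) = -xi α ε A (-K) := by
  have hK : -momentum α ε A (- -xi α ε A (-K)) = K := by
    rw [neg_neg, momentum_xi hα hε hA, neg_neg]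
  symm
  rw [← eq_momentum_iff hα hε hA, ← rot_momentum_neg, hK]

theorem eq_ofVec_of_coe {W : SU2} {u : Vec} {c : ℝ} (hc : 0 < c)
    (h : (W : Matrix (Fin 2) (Fin 2) ℂ) = (c : ℂ) • (1 + hat u)) : W = ofVec u := by
  have ht : tr W = 2 * c := by
    simp [tr, h, Matrix.trace_fin_two, hat]
    ring
  refine eq_ofVec_iff.1 ⟨by rw [ht]; positivity, ?_⟩
  rw [h, vee_smul, vee_one_add_hat, smul_smul, ht]
  field_simp
  simp

theorem mul_mul_one_add_hat {α : ℝ} (hα : α ≠ 0) {A : Vec} (hA : A ⬝ᵥ A = 1) (u : Vec) :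
    (1 + hat u) * (1 + hat ((A ⬝ᵥ u / α) • A)) * (1 + hat (-(A ⬝ᵥ u) • A)) =
      ((1 + (A ⬝ᵥ u) ^ 2 / 4 : ℝ) : ℂ) •
        (1 + hat ((1 / α) • u - (2 * (1 - α) / α) • tilt A (-u))) := by
  have hsq : hat A * hat A = ((-(1 / 4) : ℝ) : ℂ) • 1 := by
    rw [hat_mul_hat, hA, cross_self, smul_zero]
    have : hat 0 = 0 := by simpa using hat_smul 0 0
    rw [this, add_zero]
  set x := A ⬝ᵥ u with hx
  -- The two factors along `A` commute and `(hat A)² = -1/4`, so their product is a scalar plus a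
  -- multiple of `hat A`; only one genuine quaternion product remains.
  have h2 : (1 + hat ((x / α) • A)) * (1 + hat (-x • A)) =
      ((1 + x ^ 2 / (4 * α) : ℝ) : ℂ) • 1 + ((x / α - x : ℝ) : ℂ) • hat A := by
    simp only [hat_smul, Matrix.add_mul, Matrix.mul_add, Matrix.mul_one, Matrix.one_mul,
      Matrix.smul_mul, Matrix.mul_smul, hsq]
    push_cast
    have : (α : ℂ) ≠ 0 := by exact_mod_cast hα
    match_scalars <;> field_simp <;> ring
  rw [Matrix.mul_assoc, h2, tilt_eq hA, dotProduct_neg, ← hx]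
  have h3 : (1 / α) • u - (2 * (1 - α) / α) • ((2 * (1 + (-x) ^ 2 / 4))⁻¹ •
      (-x • A - -u + (-x / 2) • (A ⨯₃ (-u)))) = (1 + x ^ 2 / 4)⁻¹ •
        ((1 + x ^ 2 / (4 * α)) • u + (x / α - x) • A + ((x / α - x) / 2) • (u ⨯₃ A)) := by
    rw [map_neg, ← cross_anticomm]
    ext i
    simp only [Pi.add_apply, Pi.sub_apply, Pi.smul_apply, smul_eq_mul, Pi.neg_apply]
    have h1 : 0 < 4 + x ^ 2 := by positivity
    field_simp
    ring
  have hp : (0 : ℝ) < 1 + x ^ 2 / 4 := by positivity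
  rw [h3, smul_add, ← hat_smul, ← hat_smul, smul_smul, mul_inv_cancel₀ hp.ne', one_smul]
  simp only [hat_add, hat_smul, Matrix.add_mul, Matrix.mul_add, Matrix.mul_one, Matrix.one_mul,
      Matrix.mul_smul, hat_mul_hat, dotProduct_comm u A, ← hx]
  push_cast
  have : (α : ℂ) ≠ 0 := by exact_mod_cast hα
  match_scalars <;> field_simp <;> ring

/-- The angular velocity factorizes into elementary Cayley rotations. -/
theorem ofVec_neg_xi_neg {α : ℝ} (ε : ℝ) (hα : α ≠ 0) {A : Vec} (hA : A ⬝ᵥ A = 1) (K : Vec) :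
    ofVec (-xi α ε A (-K)) = ofVec (ε • K) * ofVec ((A ⬝ᵥ (ε • K) / α) • A) *
      ofVec (-(A ⬝ᵥ (ε • K)) • A) := by
  have h : -xi α ε A (-K) =
      (1 / α) • (ε • K) - (2 * (1 - α) / α) • tilt A (-(ε • K)) := by
    rw [xi_eq_tilt, smul_neg]
    module
  rw [h]
  have hs : ∀ v : Vec, 0 < (√(1 + v ⬝ᵥ v / 4))⁻¹ := fun v =>
    inv_pos.2 (Real.sqrt_pos.2 (one_add_dot_pos v))
  symm
  -- The scalar `c` collects the three normalizing factors and the scalar from the matrix product.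
  -- Its positivity excludes the antipode `-W`, which induces the same rotation.
  refine eq_ofVec_of_coe (c := (√(1 + (ε • K) ⬝ᵥ (ε • K) / 4))⁻¹ *
    (√(1 + ((A ⬝ᵥ (ε • K) / α) • A) ⬝ᵥ ((A ⬝ᵥ (ε • K) / α) • A) / 4))⁻¹ *
    (√(1 + (-(A ⬝ᵥ (ε • K)) • A) ⬝ᵥ (-(A ⬝ᵥ (ε • K)) • A) / 4))⁻¹ *
    (1 + (A ⬝ᵥ (ε • K)) ^ 2 / 4)) ?_ ?_
  · have := hs (ε • K)
    have := hs ((A ⬝ᵥ (ε • K) / α) • A)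
    have := hs (-(A ⬝ᵥ (ε • K)) • A)
    positivity
  · rw [Complex.ofReal_mul _ (1 + _), mul_smul, ← mul_mul_one_add_hat hα hA]
    simp only [Submonoid.coe_mul, ofVec, Matrix.smul_mul, Matrix.mul_smul, smul_smul,
      ← Complex.ofReal_mul]
    congr 2
    ring

theorem rot_neg_xi_neg {α : ℝ} (ε : ℝ) (hα : α ≠ 0) {A : Vec} (hA : A ⬝ᵥ A = 1) (K v : Vec) :
    rot (-xi α ε A (-K)) v = rot (-(A ⬝ᵥ (ε • K)) • A) (rot ((A ⬝ᵥ (ε • K) / α) • A)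
      (rot (ε • K) v)) := by
  simp only [← conj_ofVec, ofVec_neg_xi_neg ε hα hA, conj_mul]

/-! ### Lie derivatives of the discrete Lagrangian -/

section
-- The norm serves only to differentiate the exponential; the derivatives extracted below are those
-- of real and vector-valued functions.
attribute [local instance] Matrix.linftyOpNormedRing Matrix.linftyOpNormedAlgebra

theorem hasDerivAt_exp_smul_hat (η : Vec) :
    HasDerivAt (fun s : ℝ => NormedSpace.exp (hat (s • η))) (hat η) 0 := by
  have h := hasDerivAt_exp_smul_const (𝕂 := ℝ) (hat η) (0 : ℝ)
  rw [zero_smul, NormedSpace.exp_zero, one_mul] at h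
  refine h.congr_of_eventuallyEq (Filter.Eventually.of_forall fun s => ?_)
  simp only [hat_smul]
  rfl

theorem expSU_neg (η : Vec) : expSU (-η) = (expSU η)⁻¹ := by
  refine eq_inv_of_mul_eq_one_right (Subtype.ext ?_)
  rw [Submonoid.coe_mul, Submonoid.coe_one]
  simp only [expSU, hat_neg, Matrix.exp_neg]
  exact Matrix.mul_nonsing_inv _ ((Matrix.isUnit_iff_isUnit_det _).1 (Matrix.isUnit_exp (hat η)))

theorem expSU_mul (η : Vec) (W : SU2) : expSU η * W = W * expSU (conj W η) := by
  have hW := isUnit_coe W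
  apply Subtype.ext
  rw [Submonoid.coe_mul, Submonoid.coe_mul]
  simp only [expSU, hat_conj_SU2]
  rw [Matrix.exp_conj' _ _ ((Matrix.isUnit_iff_isUnit_det _).2 hW), ← Matrix.mul_assoc,
    ← Matrix.mul_assoc, Matrix.mul_nonsing_inv _ hW, Matrix.one_mul]

theorem hasDerivAt_mul_hat_mul (C η : Vec) :
    HasDerivAt (fun s : ℝ => NormedSpace.exp (hat (s • -η)) * hat C *
      NormedSpace.exp (hat (s • η))) (hat (C ⨯₃ η)) 0 := by
  have h1 := hasDerivAt_exp_smul_hat η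
  have h2 := hasDerivAt_exp_smul_hat (-η)
  have h3 := (h2.mul_const (hat C)).mul h1
  have h0 : hat 0 = 0 := by simpa using hat_smul 0 0
  refine h3.congr_deriv ?_
  rw [zero_smul, zero_smul, h0, NormedSpace.exp_zero, hat_cross, hat_neg]
  simp [sub_eq_neg_add]

theorem hasDerivAt_conj_expSU (C η : Vec) :
    HasDerivAt (fun s : ℝ => conj (expSU (s • η)) C) (C ⨯₃ η) 0 := by
  let V : Matrix (Fin 2) (Fin 2) ℂ →ₗ[ℝ] Vec :=
    { toFun := vee
      map_add' := fun X Y => by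
        ext i
        fin_cases i <;> simp [vee] <;> ring
      map_smul' := fun c X => vee_smul c X }
  have h := (V.toContinuousLinearMap.hasFDerivAt).comp_hasDerivAt (0 : ℝ) (hasDerivAt_mul_hat_mul C η)
  refine (h.congr_deriv (vee_hat _)).congr_of_eventuallyEq (Filter.Eventually.of_forall fun s => ?_)
  simp only [conj, ← coe_inv, ← expSU_neg, ← smul_neg]
  rfl

theorem hasDerivAt_tr_mul_expSU (W : SU2) (η : Vec) :
    HasDerivAt (fun s : ℝ => tr (W * expSU (s • η))) (-(1 / 2) * (vee W ⬝ᵥ η)) 0 := by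
  let V : Matrix (Fin 2) (Fin 2) ℂ →ₗ[ℝ] ℝ :=
    { toFun := fun X => (W.1 * X).trace.re
      map_add' := fun X Y => by simp [Matrix.mul_add]
      map_smul' := fun c X => by simp }
  have h := (V.toContinuousLinearMap.hasFDerivAt).comp_hasDerivAt (0 : ℝ) (hasDerivAt_exp_smul_hat η)
  refine h.congr_deriv ?_
  change (W.1 * hat η).trace.re = _
  rw [coe_eq W, Matrix.add_mul, hat_mul_hat, Matrix.smul_mul, Matrix.one_mul, Matrix.trace_add,
    Matrix.trace_add, Matrix.trace_smul, Matrix.trace_smul, trace_hat, trace_hat, Matrix.trace_one,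
    ← coe_eq W, Fintype.card_fin]
  simp
  ring

end

theorem _root_.HasDerivAt.const_dotProduct {f : ℝ → Vec} {f' : Vec} {x : ℝ} (hf : HasDerivAt f f' x)
    (A : Vec) : HasDerivAt (fun s => A ⬝ᵥ f s) (A ⬝ᵥ f') x := by
  simp only [dotProduct]
  exact HasDerivAt.fun_sum fun i _ => (hasDerivAt_pi.1 hf i).const_mul _

theorem HasLieDeriv.unique {f : SU2 → ℝ} {g : SU2} {ξ ζ : Vec} (h₁ : HasLieDeriv f g ξ)
    (h₂ : HasLieDeriv f g ζ) : ξ = ζ :=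
  dotProduct_eq _ _ fun η => (h₁ η).unique (h₂ η)

theorem expSU_zero : expSU 0 = 1 := by
  apply Subtype.ext
  have h0 : hat 0 = 0 := by simpa using hat_smul 0 0
  simp [expSU, h0, NormedSpace.exp_zero]

theorem hasLieDeriv_lagr (α ε : ℝ) {A : Vec} (hA : A ⬝ᵥ A = 1) (P : Vec) {W : SU2}
    (hW : 0 < tr W) :
    HasLieDeriv (lagr α ε A P) W (momentum α ε A ((2 / tr W) • vee W)) := by
  intro η
  have hC : conj W A = rot ((2 / tr W) • vee W) A := by
    rw [← conj_ofVec, ← eq_ofVec_iff.1 ⟨hW, rfl⟩]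
  have h0 : 0 < 1 + A ⬝ᵥ conj W A := by
    rw [hC]
    exact one_add_dot_rot_pos hA _
  have h1 := (hasDerivAt_tr_mul_expSU W η).log (by simpa [expSU_zero] using hW.ne')
  have h2 := ((hasDerivAt_conj_expSU (conj W A) η).const_dotProduct A).const_add 1
  have e0 : conj (expSU ((0 : ℝ) • η)) (conj W A) = conj W A := by
    rw [zero_smul, expSU_zero, conj_one]
  have h3 := h2.log (by rw [e0]; exact h0.ne')
  rw [e0] at h3
  have h4 := ((h1.const_mul (-(4 * α / ε))).sub (h3.const_mul (2 * (1 - α) / ε))).sub_const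
    (ε * (P ⬝ᵥ A))
  rw [zero_smul, expSU_zero, mul_one] at h4
  refine (h4.congr_deriv ?_).congr_of_eventuallyEq (Filter.Eventually.of_forall fun s => ?_)
  rotate_left
  · simp only [lagr, conj_mul, Pi.sub_apply]
  · have h5 : A ⬝ᵥ conj W A ⨯₃ η = A ⨯₃ conj W A ⬝ᵥ η := by
      rw [triple_product_permutation, triple_product_permutation, dotProduct_comm]
    rw [momentum, tilt, ← hC, sub_dotProduct]
    simp only [smul_dotProduct, smul_eq_mul, h5]
    field_simp
    ring

theorem hasLieDeriv_lagr_iff (α ε : ℝ) {A : Vec} (hA : A ⬝ᵥ A = 1) (P : Vec) {W : SU2}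
    (hW : 0 < tr W) (M : Vec) :
    HasLieDeriv (lagr α ε A P) W M ↔ M = momentum α ε A ((2 / tr W) • vee W) :=
  ⟨fun h => h.unique (hasLieDeriv_lagr α ε hA P hW), fun h => h ▸ hasLieDeriv_lagr α ε hA P hW⟩

theorem hasLieDeriv_lagr_iff_isAngVel {α ε : ℝ} (hα : α ≠ 0) (hε : ε ≠ 0) {A : Vec}
    (hA : A ⬝ᵥ A = 1) (P M : Vec) (W : SU2) :
    (0 < tr W ∧ HasLieDeriv (lagr α ε A P) W M) ↔ IsAngVel α ε A M W :=
  and_congr_right fun hW => by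
    rw [hasLieDeriv_lagr_iff α ε hA P hW, eq_momentum_iff hα hε hA]

theorem hasLieDeriv_discLagr_right {α ε : ℝ} {A p : Vec} {g g' : SU2} {M : Vec}
    (h : HasLieDeriv (lagr α ε A (conj g p)) (g⁻¹ * g') M) :
    HasLieDeriv (fun x => discLagr α ε A p g x) g' M := by
  intro η
  have := h η
  simpa only [discLagr, mul_assoc] using this

theorem hasLieDeriv_discLagr_left {α ε : ℝ} {A p : Vec} {g g' : SU2} {M : Vec}
    (h : HasLieDeriv (lagr α ε A (conj g p)) (g⁻¹ * g') M) :
    HasLieDeriv (fun x => discLagr α ε A p x g') g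
      (ε • (conj g p ⨯₃ A) - conj ((g⁻¹ * g')⁻¹ : SU2) M) := by
  intro η
  set W := g⁻¹ * g' with hW
  -- Moving `g` to `g exp(sη)` changes `W` to `exp(-sη) W = W exp(-s W⁻¹ηW)`, which is the direction
  -- used here.
  have h1 := h (-conj W η)
  have h2 := ((hasDerivAt_conj_expSU (conj g p) η).const_dotProduct A).const_mul ε
  -- `P` moves as well: `h1` contains the potential at the fixed `P`, so the constant cancels it and
  -- `h2` supplies the moving one.
  have h3 := (h1.sub h2).add_const (ε * (A ⬝ᵥ conj g p))
  refine (h3.congr_deriv ?_).congr_of_eventuallyEq (Filter.Eventually.of_forall fun s => ?_)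
  rotate_left
  · have h4 : (g * expSU (s • η))⁻¹ * g' = W * expSU (s • -conj W η) := by
      rw [mul_inv_rev, ← expSU_neg, mul_assoc, ← hW, expSU_mul, conj_neg, conj_smul, smul_neg]
    simp only [discLagr, h4, conj_mul, lagr, Pi.sub_apply, dotProduct_comm _ A]
    ring
  · have h5 : A ⬝ᵥ conj g p ⨯₃ η = - (conj g p ⨯₃ A ⬝ᵥ η) := by
      rw [triple_product_permutation, triple_product_permutation, dotProduct_comm,
        ← cross_anticomm, neg_dotProduct]
    rw [h5, sub_dotProduct, smul_dotProduct, dotProduct_neg, ← conj_dot W (conj _ M), conj_conj_inv,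
      smul_eq_mul]
    ring

theorem eulerLagrange_iff {α ε : ℝ} {A p : Vec} {g₀ g₁ g₂ : SU2} {M₁ M₂ : Vec}
    (h₁ : HasLieDeriv (lagr α ε A (conj g₀ p)) (g₀⁻¹ * g₁) M₁)
    (h₂ : HasLieDeriv (lagr α ε A (conj g₁ p)) (g₁⁻¹ * g₂) M₂) :
    EulerLagrange (discLagr α ε A p) g₀ g₁ g₂ ↔
      M₂ = conj (g₁⁻¹ * g₂ : SU2) (M₁ + ε • (conj g₁ p ⨯₃ A)) := by
  have hl := hasLieDeriv_discLagr_left h₂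
  have hr := hasLieDeriv_discLagr_right h₁
  have key : ε • (conj g₁ p ⨯₃ A) - conj ((g₁⁻¹ * g₂)⁻¹ : SU2) M₂ + M₁ = 0 ↔
      M₂ = conj (g₁⁻¹ * g₂ : SU2) (M₁ + ε • (conj g₁ p ⨯₃ A)) := by
    constructor
    · intro h
      rw [show M₁ + ε • (conj g₁ p ⨯₃ A) = conj ((g₁⁻¹ * g₂)⁻¹ : SU2) M₂ by
        rw [← sub_eq_zero, ← h]; abel, conj_conj_inv]
    · intro h
      rw [h, conj_inv_conj]
      abel
  rw [← key]
  constructor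
  · rintro ⟨ξ₁, ξ₂, h₁', h₂', h⟩
    rwa [hl.unique h₁', hr.unique h₂']
  · exact fun h => ⟨_, _, hl, hr, h⟩

theorem eulerLagrange_system_iff {α ε : ℝ} (hα : α ≠ 0) (hε : ε ≠ 0) {A : Vec} (hA : A ⬝ᵥ A = 1)
    (p : Vec) {k₀ k₁ : ℤ} {g W : ℤ → SU2} {M P : ℤ → Vec}
    (hg : ∀ k, k₀ ≤ k → k < k₁ → g (k + 1) = g k * W k) :
    (P k₀ = conj (g k₀) p ∧
        (∀ k, k₀ ≤ k → k < k₁ →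
          P (k + 1) = conj (g (k + 1)) p ∧ 0 < tr (W k) ∧
            HasLieDeriv (lagr α ε A (P k)) (W k) (M (k + 1))) ∧
        (∀ k, k₀ < k → k < k₁ →
          EulerLagrange (discLagr α ε A p) (g (k - 1)) (g k) (g (k + 1))))
      ↔
       (P k₀ = conj (g k₀) p ∧
        (∀ k, k₀ ≤ k → k < k₁ →
          P (k + 1) = conj (W k) (P k) ∧ IsAngVel α ε A (M (k + 1)) (W k)) ∧
        (∀ k, k₀ < k → k < k₁ →
          M (k + 1) = conj (W k) (M k + ε • (P k ⨯₃ A)))) := by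
  refine and_congr_right fun h0 => ?_
  simp only [hasLieDeriv_lagr_iff_isAngVel hα hε hA]
  have hW : ∀ k, k₀ ≤ k → k < k₁ → (g k)⁻¹ * g (k + 1) = W k := fun k h h' => by
    rw [hg k h h', inv_mul_cancel_left]
  have el : (∀ k, k₀ ≤ k → k < k₁ → P k = conj (g k) p) →
      (∀ k, k₀ ≤ k → k < k₁ → IsAngVel α ε A (M (k + 1)) (W k)) → ∀ k, k₀ < k → k < k₁ →
      (EulerLagrange (discLagr α ε A p) (g (k - 1)) (g k) (g (k + 1)) ↔
        M (k + 1) = conj (W k) (M k + ε • (P k ⨯₃ A))) := by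
    intro hP hV k hk hk'
    -- Being an angular velocity does not involve `P`, so the Lie derivative may be taken at the `P`
    -- that the Euler–Lagrange equation requires.
    have h1 := ((hasLieDeriv_lagr_iff_isAngVel hα hε hA (conj (g (k - 1)) p) _ _).2
      (hV (k - 1) (by omega) (by omega))).2
    have h2 := ((hasLieDeriv_lagr_iff_isAngVel hα hε hA (conj (g k) p) _ _).2
      (hV k hk.le hk')).2
    rw [← hW _ (by omega) (by omega), sub_add_cancel] at h1
    rw [← hW _ hk.le hk'] at h2
    rw [eulerLagrange_iff h1 h2, hW k hk.le hk', hP k hk.le hk']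
  constructor
  · rintro ⟨h1, h2⟩
    have hP : ∀ k, k₀ ≤ k → k < k₁ → P k = conj (g k) p := fun k hk hk' => by
      rcases hk.eq_or_lt with rfl | hlt
      · exact h0
      · have := (h1 (k - 1) (by omega) (by omega)).1
        rwa [sub_add_cancel] at this
    refine ⟨fun k hk hk' => ⟨?_, (h1 k hk hk').2⟩, fun k hk hk' =>
      (el hP (fun k hk hk' => (h1 k hk hk').2) k hk hk').1 (h2 k hk hk')⟩
    rw [(h1 k hk hk').1, hg k hk hk', conj_mul, hP k hk hk']
  · rintro ⟨h1, h2⟩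
    have hP : ∀ k, k₀ ≤ k → k ≤ k₁ → P k = conj (g k) p := by
      refine Int.leInduction (fun _ => h0) fun k hk ih hk' => ?_
      rw [(h1 k hk (by omega)).1, ih (by omega), hg k hk (by omega), conj_mul]
    exact ⟨fun k hk hk' => ⟨hP _ (by omega) (by omega), (h1 k hk hk').2⟩, fun k hk hk' =>
      (el (fun k hk hk' => hP k hk hk'.le) (fun k hk hk' => (h1 k hk hk').2) k hk hk').2
        (h2 k hk hk')⟩

/-! ### Calculus on `ℝ³` and on the phase space -/

theorem _root_.HasDerivAt.vec_dot {f g : ℝ → Vec} {f' g' : Vec} {x : ℝ} (hf : HasDerivAt f f' x)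
    (hg : HasDerivAt g g' x) :
    HasDerivAt (fun s => f s ⬝ᵥ g s) (f' ⬝ᵥ g x + f x ⬝ᵥ g') x := by
  simp only [dotProduct, ← Finset.sum_add_distrib]
  exact HasDerivAt.fun_sum fun i _ => (hasDerivAt_pi.1 hf i).mul (hasDerivAt_pi.1 hg i)

theorem _root_.HasDerivAt.vec_cross {f g : ℝ → Vec} {f' g' : Vec} {x : ℝ} (hf : HasDerivAt f f' x)
    (hg : HasDerivAt g g' x) :
    HasDerivAt (fun s => f s ⨯₃ g s) (f' ⨯₃ g x + f x ⨯₃ g') x := by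
  rw [hasDerivAt_pi] at *
  have key : ∀ i j k l : Fin 3, HasDerivAt (fun s => f s i * g s j - f s k * g s l)
      (f' i * g x j + f x i * g' j - (f' k * g x l + f x k * g' l)) x := fun i j k l =>
    ((hf i).mul (hg j)).sub ((hf k).mul (hg l))
  intro i
  fin_cases i
  · exact (key 1 2 2 1).congr_deriv (by simp [cross_apply]; ring)
  · exact (key 2 0 0 2).congr_deriv (by simp [cross_apply]; ring)
  · exact (key 0 1 1 0).congr_deriv (by simp [cross_apply]; ring)

theorem _root_.ContDiff.vec_dot {E : Type*} [NormedAddCommGroup E] [NormedSpace ℝ E] {f g : E → Vec}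
    {n : WithTop ℕ∞} (hf : ContDiff ℝ n f) (hg : ContDiff ℝ n g) :
    ContDiff ℝ n fun s => f s ⬝ᵥ g s := by
  simp only [dotProduct]
  exact ContDiff.sum fun i _ => (contDiff_pi.1 hf i).mul (contDiff_pi.1 hg i)

theorem _root_.ContDiff.vec_cross {E : Type*} [NormedAddCommGroup E] [NormedSpace ℝ E]
    {f g : E → Vec} {n : WithTop ℕ∞} (hf : ContDiff ℝ n f) (hg : ContDiff ℝ n g) :
    ContDiff ℝ n fun s => f s ⨯₃ g s := by
  rw [contDiff_pi] at *
  have key : ∀ i j k l : Fin 3, ContDiff ℝ n (fun s => f s i * g s j - f s k * g s l) :=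
    fun i j k l => ((hf i).mul (hg j)).sub ((hf k).mul (hg l))
  intro i
  fin_cases i
  · exact key 1 2 2 1
  · exact key 2 0 0 2
  · exact key 0 1 1 0

theorem _root_.ContDiff.rot {E : Type*} [NormedAddCommGroup E] [NormedSpace ℝ E]
    {f g : E → Vec} {n : WithTop ℕ∞} (hf : ContDiff ℝ n f) (hg : ContDiff ℝ n g) :
    ContDiff ℝ n fun s => rot (f s) (g s) := by
  simp only [rot_eq]
  have hN : ContDiff ℝ n fun s => 1 + f s ⬝ᵥ f s / 4 :=
    contDiff_const.add ((hf.vec_dot hf).div_const 4)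
  refine (hN.inv fun s => (one_add_dot_pos _).ne').smul
    ((((contDiff_const.sub ((hf.vec_dot hf).div_const 4)).smul hg).add (hg.vec_cross hf)).add
      ((contDiff_const.mul (hf.vec_dot hg)).smul hf))

/-- The infinitesimal rotation of the Cayley transform at `u` in the direction `δ`. -/
def cayleyForm (u δ : Vec) : Vec := (1 + u ⬝ᵥ u / 4)⁻¹ • (δ + (1 / 2 : ℝ) • (u ⨯₃ δ))

/-- Varying the axis by `δ` acts on the rotated vector as an infinitesimal rotation, `cayleyForm u
δ` in the frame before applying `rot u`. -/
theorem hasDerivAt_rot (u δ v w : Vec) :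
    HasDerivAt (fun s : ℝ => rot (u + s • δ) (v + s • w)) (rot u (w + v ⨯₃ cayleyForm u δ)) 0 := by
  have line : ∀ a b : Vec, HasDerivAt (fun s : ℝ => a + s • b) b 0 := fun a b => by
    simpa using ((hasDerivAt_id (0 : ℝ)).smul_const b).const_add a
  have hu := line u δ
  have hv := line v w
  have hN := one_add_dot_pos u
  have h1 := (((hu.vec_dot hu).div_const 4).const_add 1).inv (by simpa using hN.ne')
  have h2 := (((((hu.vec_dot hu).div_const 4).const_sub 1).smul hv).add (hv.vec_cross hu)).add
    (((hu.vec_dot hv).const_mul (1 / 2)).smul hu)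
  simp only [rot_eq]
  refine (h1.smul h2).congr_deriv ?_
  simp only [Pi.add_apply, Pi.smul_apply', zero_smul, add_zero, Pi.inv_apply, cayleyForm]
  set N := 1 + u ⬝ᵥ u / 4 with hNd
  have hr : N⁻¹ * (1 + (u 0 * u 0 + u 1 * u 1 + u 2 * u 2) / 4) = 1 := by
    rw [show 1 + (u 0 * u 0 + u 1 * u 1 + u 2 * u 2) / 4 = N by
      rw [hNd, dotProduct, Fin.sum_univ_three], inv_mul_cancel₀ hN.ne']
  have hdiv : ∀ x : ℝ, x / N ^ 2 = x * N⁻¹ ^ 2 := fun x => by rw [div_eq_mul_inv, inv_pow]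
  rw [hdiv]
  generalize N⁻¹ = r at *
  -- The derivative mixes first and second powers of `r`. Raising the first powers with `r N = 1`
  -- makes both sides homogeneous; each `e` below is a coordinate of the numerator's variation along
  -- `δ`.
  have hE : ∀ e : ℝ, r * e = r ^ 2 * ((1 + (u 0 * u 0 + u 1 * u 1 + u 2 * u 2) / 4) * e) :=
    fun e => by linear_combination (-r * e) * hr
  set D := u 0 * δ 0 + u 1 * δ 1 + u 2 * δ 2
  set S := u 0 * v 0 + u 1 * v 1 + u 2 * v 2
  set T := δ 0 * v 0 + δ 1 * v 1 + δ 2 * v 2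
  ext i
  fin_cases i
  · simp [dotProduct, Fin.sum_univ_three, cross_apply, Matrix.vecHead, Matrix.vecTail]
    linear_combination hE (-(D / 2) * v 0 + (v 1 * δ 2 - v 2 * δ 1) + S / 2 * δ 0 + T / 2 * u 0)
  · simp [dotProduct, Fin.sum_univ_three, cross_apply, Matrix.vecHead, Matrix.vecTail]
    linear_combination hE (-(D / 2) * v 1 + (v 2 * δ 0 - v 0 * δ 2) + S / 2 * δ 1 + T / 2 * u 1)
  · simp [dotProduct, Fin.sum_univ_three, cross_apply, Matrix.vecHead, Matrix.vecTail]
    linear_combination hE (-(D / 2) * v 2 + (v 0 * δ 1 - v 1 * δ 0) + S / 2 * δ 2 + T / 2 * u 2)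

theorem fderiv_eq_grad (F : Phase → ℝ) (z w : Phase) :
    fderiv ℝ F z w = gradM F z ⬝ᵥ w.1 + gradP F z ⬝ᵥ w.2 := by
  have h : w = ∑ i, w.1 i • (Pi.single i 1, (0 : Vec)) + ∑ i, w.2 i • ((0 : Vec), Pi.single i 1) := by
    ext i
    · simp [Prod.fst_sum, Finset.sum_apply, Pi.single_apply]
    · simp [Prod.snd_sum, Finset.sum_apply, Pi.single_apply]
  conv_lhs => rw [h]
  simp only [map_add, map_sum, map_smul, smul_eq_mul, dotProduct, gradM, gradP, mul_comm]

theorem grad_eq {F : Phase → ℝ} {z : Phase} {a b : Vec} (hF : DifferentiableAt ℝ F z)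
    (h : ∀ w : Phase, HasDerivAt (fun s : ℝ => F (z + s • w)) (a ⬝ᵥ w.1 + b ⬝ᵥ w.2) 0) :
    gradM F z = a ∧ gradP F z = b := by
  have key : ∀ w : Phase, fderiv ℝ F z w = a ⬝ᵥ w.1 + b ⬝ᵥ w.2 := fun w =>
    (hF.hasFDerivAt.hasLineDerivAt w).unique (h w)
  constructor <;> ext i <;> simp [gradM, gradP, key]

theorem grad_comp {Φ : Phase → Phase} {F : Phase → ℝ} {z : Phase} (hΦ : Differentiable ℝ Φ)
    (hF : Differentiable ℝ F) {D : Phase → Phase}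
    (hD : ∀ w, HasDerivAt (fun s : ℝ => Φ (z + s • w)) (D w) 0) (w : Phase) :
    gradM (F ∘ Φ) z ⬝ᵥ w.1 + gradP (F ∘ Φ) z ⬝ᵥ w.2 =
      gradM F (Φ z) ⬝ᵥ (D w).1 + gradP F (Φ z) ⬝ᵥ (D w).2 := by
  rw [← fderiv_eq_grad, ← fderiv_eq_grad, fderiv_comp z (hF _) (hΦ _),
    ContinuousLinearMap.comp_apply]
  congr 1
  exact ((hΦ z).hasFDerivAt.hasLineDerivAt w).unique (hD w)

theorem grad_comp_eq {Φ : Phase → Phase} {F : Phase → ℝ} {z : Phase} (hΦ : Differentiable ℝ Φ)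
    (hF : Differentiable ℝ F) {D : Phase → Phase}
    (hD : ∀ w, HasDerivAt (fun s : ℝ => Φ (z + s • w)) (D w) 0) {a b : Vec}
    (h : ∀ w, gradM F (Φ z) ⬝ᵥ (D w).1 + gradP F (Φ z) ⬝ᵥ (D w).2 = a ⬝ᵥ w.1 + b ⬝ᵥ w.2) :
    gradM (F ∘ Φ) z = a ∧ gradP (F ∘ Φ) z = b := by
  have key : ∀ w : Phase, _ := fun w => (grad_comp hΦ hF hD w).trans (h w)
  exact ⟨dotProduct_eq _ _ fun w => by simpa using key (w, 0),
    dotProduct_eq _ _ fun w => by simpa using key (0, w)⟩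

theorem IsPoissonMap.comp {Φ Ψ : Phase → Phase} (hΦ : IsPoissonMap Φ) (hΨ : IsPoissonMap Ψ) :
    IsPoissonMap (Φ ∘ Ψ) :=
  ⟨hΦ.1.comp hΨ.1, fun F G hF hG z => by
    have hd : Differentiable ℝ Φ := hΦ.1.differentiable (by simp)
    exact (hΨ.2 (F ∘ Φ) (G ∘ Φ) (hF.comp hd) (hG.comp hd) z).trans (hΦ.2 F G hF hG _)⟩

/-! ### The elementary Poisson maps -/

/-- The time `ε` flow of `⟨P, A⟩`. -/
def shift (ε : ℝ) (A : Vec) (z : Phase) : Phase := (z.1 + ε • (z.2 ⨯₃ A), z.2)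

theorem contDiff_shift (ε : ℝ) (A : Vec) : ContDiff ℝ ∞ (shift ε A) :=
  (contDiff_fst.add ((contDiff_snd.vec_cross contDiff_const).const_smul ε)).prodMk contDiff_snd

theorem isPoissonMap_shift (ε : ℝ) (A : Vec) : IsPoissonMap (shift ε A) := by
  refine ⟨contDiff_shift ε A, fun F G hF hG z => ?_⟩
  have hD : ∀ w, HasDerivAt (fun s : ℝ => shift ε A (z + s • w)) (shift ε A w) 0 := fun w => by
    have h : ∀ s : ℝ, shift ε A (z + s • w) = shift ε A z + s • shift ε A w := fun s => by
      ext i <;> simp [shift]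
      ring
    simp only [h]
    simpa using ((hasDerivAt_id (0 : ℝ)).smul_const (shift ε A w)).const_add (shift ε A z)
  have grads : ∀ F : Phase → ℝ, Differentiable ℝ F →
      gradM (F ∘ shift ε A) z = gradM F (shift ε A z) ∧ gradP (F ∘ shift ε A) z =
        gradP F (shift ε A z) + ε • (A ⨯₃ gradM F (shift ε A z)) := fun F hF => by
    refine grad_comp_eq ((contDiff_shift ε A).differentiable (by simp)) hF hD fun w => ?_
    generalize gradM F _ = a
    simp only [shift, dotProduct_add, add_dotProduct, dotProduct_smul, smul_dotProduct]
    rw [triple_product_permutation, dotProduct_comm w.2]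
    ring
  simp only [bracket, grads F hF, grads G hG]
  generalize gradM F _ = a
  generalize gradM G _ = c
  generalize gradP F _ = b
  generalize gradP G _ = d
  simp [shift, cross_apply, dotProduct, Fin.sum_univ_three, Matrix.vecHead, Matrix.vecTail]
  ring

/-- The map `(M, P) ↦ (u⁻¹ M u, u⁻¹ P u)` with `u = 𝟏 + L M`. -/
def twist (L : Vec →ₗ[ℝ] Vec) (z : Phase) : Phase := (rot (L z.1) z.1, rot (L z.1) z.2)

theorem contDiff_twist (L : Vec →ₗ[ℝ] Vec) : ContDiff ℝ ∞ (twist L) := by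
  have hL : ContDiff ℝ ∞ fun z : Phase => L z.1 :=
    L.toContinuousLinearMap.contDiff.comp contDiff_fst
  exact (hL.rot contDiff_fst).prodMk (hL.rot contDiff_snd)

theorem rot_neg_dot (u a b : Vec) : rot (-u) a ⬝ᵥ b = a ⬝ᵥ rot u b := by
  rw [← rot_dot u, rot_rot_neg]

/-- `twist L` is Poisson when the adjoint `Q M` of the infinitesimal rotation satisfies a
Maurer–Cartan type identity. -/
theorem isPoissonMap_twist (L : Vec →ₗ[ℝ] Vec) (Q : Vec → Vec → Vec)
    (hQ : ∀ M s w, Q M s ⬝ᵥ w = s ⬝ᵥ cayleyForm (L M) (L w))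
    (hMC : ∀ M s t, Q M s ⬝ᵥ t - Q M t ⬝ᵥ s + M ⬝ᵥ (Q M s ⨯₃ Q M t) = 0) :
    IsPoissonMap (twist L) := by
  refine ⟨contDiff_twist L, fun F G hF hG z => ?_⟩
  obtain ⟨M, P⟩ := z
  set u := L M with hu
  have hD : ∀ w : Phase, HasDerivAt (fun s : ℝ => twist L ((M, P) + s • w))
      (rot u (w.1 + M ⨯₃ cayleyForm u (L w.1)), rot u (w.2 + P ⨯₃ cayleyForm u (L w.1))) 0 :=
    fun w => by
      have h1 := hasDerivAt_rot u (L w.1) M w.1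
      have h2 := hasDerivAt_rot u (L w.1) P w.2
      simpa [twist] using h1.prodMk h2
  have grads : ∀ F : Phase → ℝ, Differentiable ℝ F →
      gradM (F ∘ twist L) (M, P) = rot (-u) (gradM F (twist L (M, P))) +
        Q M (rot (-u) (gradM F (twist L (M, P))) ⨯₃ M + rot (-u) (gradP F (twist L (M, P))) ⨯₃ P) ∧
      gradP (F ∘ twist L) (M, P) = rot (-u) (gradP F (twist L (M, P))) := fun F hF => by
    refine grad_comp_eq ((contDiff_twist L).differentiable (by simp)) hF hD fun w => ?_
    rw [← rot_neg_dot, ← rot_neg_dot, add_dotProduct, hQ]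
    generalize rot (-u) (gradM F _) = a
    generalize rot (-u) (gradP F _) = b
    generalize cayleyForm _ _ = c
    simp [cross_apply, dotProduct, Fin.sum_univ_three]
    ring
  obtain ⟨a, ha⟩ : ∃ a, rot u a = gradM F (twist L (M, P)) := ⟨_, rot_rot_neg _ _⟩
  obtain ⟨b, hb⟩ : ∃ b, rot u b = gradP F (twist L (M, P)) := ⟨_, rot_rot_neg _ _⟩
  obtain ⟨c, hc⟩ : ∃ c, rot u c = gradM G (twist L (M, P)) := ⟨_, rot_rot_neg _ _⟩
  obtain ⟨d, hd⟩ : ∃ d, rot u d = gradP G (twist L (M, P)) := ⟨_, rot_rot_neg _ _⟩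
  rw [bracket, bracket, (grads F hF).1, (grads F hF).2, (grads G hG).1, (grads G hG).2, ← ha, ← hb,
    ← hc, ← hd]
  simp only [rot_neg_rot, twist, ← hu, ← rot_cross u, rot_dot]
  -- With `s`, `t` these two vectors and `q`, `r` their images under `Q M`, the terms of the
  -- pulled-back bracket containing `q` or `r` add up to `q·t - r·s + M·(q × r)`. The rest is the
  -- bracket at the image point, by invariance under `rot u`.
  have h := hMC M (a ⨯₃ M + b ⨯₃ P) (c ⨯₃ M + d ⨯₃ P)
  generalize Q M (a ⨯₃ M + b ⨯₃ P) = q at *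
  generalize Q M (c ⨯₃ M + d ⨯₃ P) = r at *
  simp [cross_apply, dotProduct, Fin.sum_univ_three] at h ⊢
  linear_combination h

theorem isPoissonMap_twist_smul (ε : ℝ) : IsPoissonMap (twist (ε • LinearMap.id)) := by
  refine isPoissonMap_twist _ (fun M s => (1 + (ε • M) ⬝ᵥ (ε • M) / 4)⁻¹ •
    (ε • (s - (1 / 2 : ℝ) • ((ε • M) ⨯₃ s)))) (fun M s w => ?_) (fun M s t => ?_)
  · simp [cayleyForm, cross_apply, dotProduct, Fin.sum_univ_three, Matrix.vecHead, Matrix.vecTail]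
    ring
  · have hr := inv_mul_cancel₀ (one_add_dot_pos (ε • M)).ne'
    generalize (1 + (ε • M) ⬝ᵥ (ε • M) / 4)⁻¹ = r at *
    simp [cross_apply, dotProduct, Fin.sum_univ_three, Matrix.vecHead, Matrix.vecTail] at hr ⊢
    linear_combination (r * ε ^ 2 * (M 0 * (s 1 * t 2 - s 2 * t 1) + M 1 * (s 2 * t 0 - s 0 * t 2) +
      M 2 * (s 0 * t 1 - s 1 * t 0))) * hr

/-- The linear map `M ↦ c⟨A, M⟩A`. -/
def axisMap (c : ℝ) (A : Vec) : Vec →ₗ[ℝ] Vec where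
  toFun M := (c * (A ⬝ᵥ M)) • A
  map_add' M N := by rw [dotProduct_add, mul_add, add_smul]
  map_smul' r M := by
    rw [dotProduct_smul, smul_smul, smul_eq_mul, RingHom.id_apply, mul_left_comm]

theorem axisMap_apply (c : ℝ) (A M : Vec) : axisMap c A M = (c * (A ⬝ᵥ M)) • A := rfl

/-- All values of `Q` are multiples of `A`, so the cross product in the Maurer–Cartan identity
vanishes and the remaining two terms cancel by symmetry. -/
theorem isPoissonMap_twist_axisMap (c : ℝ) (A : Vec) : IsPoissonMap (twist (axisMap c A)) := by
  refine isPoissonMap_twist _ (fun M s => ((1 + axisMap c A M ⬝ᵥ axisMap c A M / 4)⁻¹ *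
    (c * (A ⬝ᵥ s))) • A) (fun M s w => ?_) (fun M s t => ?_)
  · simp only [cayleyForm]
    generalize (1 + axisMap c A M ⬝ᵥ axisMap c A M / 4)⁻¹ = r
    simp only [axisMap_apply, map_smul, LinearMap.smul_apply, cross_self, smul_zero, add_zero,
      dotProduct_smul, smul_dotProduct, smul_eq_mul, dotProduct_comm s A]
    ring
  · simp only [map_smul, LinearMap.smul_apply, cross_self, smul_zero, dotProduct_zero, add_zero,
      smul_dotProduct, smul_eq_mul]
    ring

/-! ### The discrete time Lagrange top -/

/-- The discrete time Lagrange top as a composition of elementary Poisson maps. -/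
def topMap (α ε : ℝ) (A : Vec) : Phase → Phase :=
  twist (axisMap (-ε) A) ∘ twist (axisMap (ε / α) A) ∘ twist (ε • LinearMap.id) ∘ shift ε A

theorem isPoissonMap_topMap (α ε : ℝ) (A : Vec) : IsPoissonMap (topMap α ε A) :=
  (isPoissonMap_twist_axisMap _ A).comp ((isPoissonMap_twist_axisMap _ A).comp
    ((isPoissonMap_twist_smul ε).comp (isPoissonMap_shift ε A)))

theorem dot_rot_smul (A M : Vec) (c : ℝ) : A ⬝ᵥ rot (c • A) M = A ⬝ᵥ M := by
  nth_rw 1 [← rot_smul_self A c]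
  exact rot_dot _ _ _

theorem topMap_eq {α : ℝ} (ε : ℝ) (hα : α ≠ 0) {A : Vec} (hA : A ⬝ᵥ A = 1) (z : Phase) :
    topMap α ε A z =
      (rot (-xi α ε A (-(z.1 + ε • (z.2 ⨯₃ A)))) (z.1 + ε • (z.2 ⨯₃ A)),
        rot (-xi α ε A (-(z.1 + ε • (z.2 ⨯₃ A)))) z.2) := by
  simp only [rot_neg_xi_neg ε hα hA, topMap, Function.comp_apply, twist, shift,
    LinearMap.smul_apply, LinearMap.id_apply, axisMap_apply, dot_rot_smul, rot_smul_self,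
    dotProduct_smul, smul_eq_mul, div_mul_eq_mul_div, neg_mul]

theorem step_iff {α ε : ℝ} (hα : α ≠ 0) (hε : ε ≠ 0) {A : Vec} (hA : A ⬝ᵥ A = 1) (z z' : Phase) :
    Step α ε A z z' ↔ z' = topMap α ε A z := by
  have h1 : Step α ε A z z' ↔ z'.1 = rot (xi α ε A z'.1) (z.1 + ε • (z.2 ⨯₃ A)) ∧
      z'.2 = rot (xi α ε A z'.1) z.2 := by
    simp only [Step, IsAngVel, eq_ofVec_iff, exists_eq_left, conj_ofVec]
  rw [h1, topMap_eq ε hα hA, Prod.ext_iff]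
  constructor
  · intro h
    rwa [xi_eq_neg_xi_neg hα hε hA h.1] at h
  · intro h
    have hx := xi_rot_neg_xi_neg hα hε hA (z.1 + ε • (z.2 ⨯₃ A))
    dsimp only at h
    rw [← h.1] at hx
    rw [hx]
    exact h

/-! ### Integrals -/

theorem contDiff_axisMomentum (A : Vec) : ContDiff ℝ ∞ (axisMomentum A) :=
  contDiff_fst.vec_dot contDiff_const

theorem contDiff_energy (ε : ℝ) (A : Vec) : ContDiff ℝ ∞ (energy ε A) :=
  ((contDiff_const.mul (contDiff_fst.vec_dot contDiff_fst)).add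
    (contDiff_snd.vec_dot contDiff_const)).add
    (contDiff_const.mul ((contDiff_fst.vec_cross contDiff_snd).vec_dot contDiff_const))

theorem axisMomentum_twist_axisMap (c : ℝ) (A : Vec) (z : Phase) :
    axisMomentum A (twist (axisMap c A) z) = axisMomentum A z := by
  simp only [axisMomentum, twist, axisMap_apply, dotProduct_comm _ A, dot_rot_smul]

theorem energy_twist_axisMap (ε c : ℝ) (A : Vec) (z : Phase) :
    energy ε A (twist (axisMap c A) z) = energy ε A z := by
  simp only [energy, twist, axisMap_apply, dotProduct_comm _ A, dot_rot_smul, rot_dot, ← rot_cross]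

theorem axisMomentum_topMap (α ε : ℝ) (A : Vec) (z : Phase) :
    axisMomentum A (topMap α ε A z) = axisMomentum A z := by
  simp only [topMap, Function.comp_apply, axisMomentum_twist_axisMap]
  simp only [axisMomentum, twist, shift, LinearMap.smul_apply, LinearMap.id_apply, rot_smul_self]
  rw [dotProduct_comm, dotProduct_add, dotProduct_smul, dot_cross_self, smul_zero, add_zero,
    dotProduct_comm]

/-- This is the vector part of `(1 + hat u) * hat (rot u v) = hat v * (1 + hat u)`: the rotation is
the Cayley transform of `½ u ×`. -/
theorem cayley_cross (u v : Vec) :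
    rot u v + (1 / 2 : ℝ) • (u ⨯₃ rot u v) = v - (1 / 2 : ℝ) • (u ⨯₃ v) := by
  have h := one_add_dot_pos u
  have hq : (1 + u ⬝ᵥ u / 4) • rot u v =
      (1 - u ⬝ᵥ u / 4) • v + v ⨯₃ u + (1 / 2 * (u ⬝ᵥ v)) • u := by
    rw [rot_eq, smul_inv_smul₀ h.ne']
  rw [← (smul_right_injective Vec h.ne').eq_iff]
  simp only [smul_add]
  rw [smul_comm _ (1 / 2 : ℝ), ← map_smul, hq]
  ext i
  fin_cases i <;> simp [dotProduct, Fin.sum_univ_three, cross_apply, Matrix.vecHead, Matrix.vecTail]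
    <;> ring

theorem energy_topMap (α ε : ℝ) (A : Vec) (z : Phase) :
    energy ε A (topMap α ε A z) = energy ε A z := by
  simp only [topMap, Function.comp_apply, energy_twist_axisMap]
  simp only [energy, twist, shift, LinearMap.smul_apply, LinearMap.id_apply, rot_smul_self]
  obtain ⟨M, P⟩ := z
  set K := M + ε • (P ⨯₃ A) with hK
  -- The twist fixes `K`, so this replaces the rotated `P` by `P` and flips the sign of the mixed
  -- term. Expanding `½|K|²` restores that sign and cancels the `ε²` terms.
  have h := congrArg (· ⬝ᵥ A) (cayley_cross (ε • K) P)
  simp only [add_dotProduct, sub_dotProduct, smul_dotProduct, map_smul, LinearMap.smul_apply,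
    smul_eq_mul] at h
  rw [add_assoc, show ε / 2 * ((K ⨯₃ rot (ε • K) P) ⬝ᵥ A) =
    1 / 2 * (ε * ((K ⨯₃ rot (ε • K) P) ⬝ᵥ A)) by ring, h, hK]
  simp [dotProduct, Fin.sum_univ_three, cross_apply, Matrix.vecHead, Matrix.vecTail]
  ring

theorem hasDerivAt_line (a b : Vec) : HasDerivAt (fun s : ℝ => a + s • b) b 0 := by
  simpa using ((hasDerivAt_id (0 : ℝ)).smul_const b).const_add a

theorem grad_axisMomentum (A : Vec) (z : Phase) :
    gradM (axisMomentum A) z = A ∧ gradP (axisMomentum A) z = 0 := by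
  refine grad_eq ((contDiff_axisMomentum A).differentiable (by simp) z) fun w => ?_
  refine ((hasDerivAt_line z.1 w.1).vec_dot (hasDerivAt_const 0 A)).congr_deriv ?_
  simp [dotProduct_comm]

theorem grad_energy (ε : ℝ) (A : Vec) (z : Phase) :
    gradM (energy ε A) z = z.1 + (ε / 2) • (z.2 ⨯₃ A) ∧
      gradP (energy ε A) z = A + (ε / 2) • (A ⨯₃ z.1) := by
  refine grad_eq ((contDiff_energy ε A).differentiable (by simp) z) fun w => ?_
  have hM := hasDerivAt_line z.1 w.1
  have hP := hasDerivAt_line z.2 w.2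
  have hA := hasDerivAt_const (0 : ℝ) A
  refine ((((hM.vec_dot hM).const_mul (1 / 2)).add (hP.vec_dot hA)).add
    (((hM.vec_cross hP).vec_dot hA).const_mul (ε / 2))).congr_deriv ?_
  simp [dotProduct, Fin.sum_univ_three, cross_apply]
  ring

theorem bracket_axisMomentum_energy (ε : ℝ) (A : Vec) (z : Phase) :
    bracket (axisMomentum A) (energy ε A) z = 0 := by
  rw [bracket, (grad_axisMomentum A z).1, (grad_axisMomentum A z).2, (grad_energy ε A z).1,
    (grad_energy ε A z).2]
  simp [dotProduct, Fin.sum_univ_three, cross_apply, Matrix.vecHead, Matrix.vecTail]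
  ring

/-! ### Symplectic leaves and independence -/

/-- The Poisson tensor of `e(3)` at `z`. -/
def poissonTensor (z : Phase) : Phase →ₗ[ℝ] Phase where
  toFun w := (z.1 ⨯₃ w.1 + z.2 ⨯₃ w.2, z.2 ⨯₃ w.1)
  map_add' v w := by
    ext i <;> simp
    ring
  map_smul' c w := by simp

theorem poissonTensor_apply (z w : Phase) :
    poissonTensor z w = (z.1 ⨯₃ w.1 + z.2 ⨯₃ w.2, z.2 ⨯₃ w.1) := rfl

theorem leafTangent_eq_range (z : Phase) : leafTangent z = LinearMap.range (poissonTensor z) := by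
  apply le_antisymm
  · rw [leafTangent, Submodule.span_le]
    rintro _ ⟨H, -, rfl⟩
    exact ⟨(gradM H z, gradP H z), rfl⟩
  · rintro _ ⟨w, rfl⟩
    -- Linear functions already realize every covector as a gradient.
    refine Submodule.subset_span ⟨fun y => w.1 ⬝ᵥ y.1 + w.2 ⬝ᵥ y.2, ?_, ?_⟩
    · exact (contDiff_const.vec_dot contDiff_fst).add (contDiff_const.vec_dot contDiff_snd)
    · have h := grad_eq (F := fun y : Phase => w.1 ⬝ᵥ y.1 + w.2 ⬝ᵥ y.2) (z := z) (a := w.1)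
        (b := w.2) (((contDiff_const (n := 1).vec_dot contDiff_fst).add
          (contDiff_const.vec_dot contDiff_snd)).differentiable (by simp) z) fun v => by
          refine (((hasDerivAt_const 0 w.1).vec_dot (hasDerivAt_line z.1 v.1)).add
            ((hasDerivAt_const 0 w.2).vec_dot (hasDerivAt_line z.2 v.2))).congr_deriv ?_
          simp
      rw [hamField, h.1, h.2, poissonTensor_apply]

theorem eq_smul_of_cross_eq_zero {P a : Vec} (hP : P ≠ 0) (h : P ⨯₃ a = 0) :
    a = (P ⬝ᵥ a / P ⬝ᵥ P) • P := by
  have hp : P ⬝ᵥ P ≠ 0 := fun h => hP (dotProduct_self_eq_zero.1 h)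
  have := cross_cross_self P a
  rw [h, map_zero] at this
  rw [div_eq_inv_mul, ← smul_smul, eq_inv_smul_iff₀ hp]
  exact (sub_eq_zero.1 this.symm).symm

/-- The two spanning vectors are the gradients of the Casimirs `⟨M, P⟩` and `½⟨P, P⟩`. -/
theorem ker_poissonTensor {z : Phase} (hP : z.2 ≠ 0) :
    LinearMap.ker (poissonTensor z) = Submodule.span ℝ (Set.range ![(z.2, z.1), (0, z.2)]) := by
  ext w
  rw [LinearMap.mem_ker, Matrix.range_cons, Matrix.range_cons, Matrix.range_empty, Set.union_empty,
    Set.singleton_union, Submodule.mem_span_pair, poissonTensor_apply, Prod.mk_eq_zero]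
  constructor
  · rintro ⟨h1, h2⟩
    have ha := eq_smul_of_cross_eq_zero hP h2
    set c := z.2 ⬝ᵥ w.1 / z.2 ⬝ᵥ z.2
    have h3 : z.2 ⨯₃ (w.2 - c • z.1) = 0 := by
      rw [map_sub, map_smul, ← h1, ha, map_smul, ← cross_anticomm z.1 z.2]
      module
    have hb := eq_smul_of_cross_eq_zero hP h3
    refine ⟨c, z.2 ⬝ᵥ (w.2 - c • z.1) / z.2 ⬝ᵥ z.2, Prod.ext ?_ ?_⟩
    · simpa using ha.symm
    · simp only [Prod.snd_add, Prod.smul_snd]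
      rw [← hb]
      abel
  · rintro ⟨c, d, rfl⟩
    refine ⟨?_, by simp⟩
    simp only [Prod.fst_add, Prod.snd_add, Prod.smul_fst, Prod.smul_snd, smul_zero, add_zero,
      map_add, map_smul, cross_self, ← cross_anticomm z.1 z.2]
    module

theorem finrank_leafTangent {z : Phase} (hP : z.2 ≠ 0) : Module.finrank ℝ (leafTangent z) = 4 := by
  have hli : LinearIndependent ℝ ![((z.2, z.1) : Phase), (0, z.2)] := by
    rw [LinearIndependent.pair_iff]
    intro s t h
    rw [Prod.ext_iff] at h
    have hs : s = 0 := by simpa [hP] using h.1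
    subst hs
    exact ⟨rfl, by simpa [hP] using h.2⟩
  have h1 := LinearMap.finrank_range_add_finrank_ker (poissonTensor z)
  rw [ker_poissonTensor hP, finrank_span_eq_card hli, ← leafTangent_eq_range] at h1
  simp at h1
  omega

/-- The polynomial whose nonvanishing implies the independence of the integrals. -/
def discriminant (ε : ℝ) (A : Vec) (z : Phase) : ℝ :=
  z.2 ⬝ᵥ (A ⨯₃ (z.1 + (ε / 2) • (z.2 ⨯₃ A)))

theorem continuous_discriminant (ε : ℝ) (A : Vec) : Continuous (discriminant ε A) := by
  have h : ContDiff ℝ 0 (discriminant ε A) :=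
    contDiff_snd.vec_dot (contDiff_const.vec_cross (contDiff_fst.add
      ((contDiff_snd.vec_cross contDiff_const).const_smul _)))
  exact h.continuous

/-- The discriminant is a quadratic form in `z`. If it vanished near `z`, this second difference
would force it to vanish at every `w`; hence density. -/
theorem discriminant_parallelogram (ε : ℝ) (A : Vec) (z w : Phase) (s : ℝ) :
    discriminant ε A (z + s • w) + discriminant ε A (z + (-s) • w) - 2 * discriminant ε A z =
      2 * s ^ 2 * discriminant ε A w := by
  simp [discriminant, dotProduct, Fin.sum_univ_three, cross_apply, Matrix.vecHead, Matrix.vecTail]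
  ring

theorem exists_discriminant_ne_zero {ε : ℝ} (hε : ε ≠ 0) {A : Vec} (hA : A ⬝ᵥ A = 1) :
    ∃ w, discriminant ε A w ≠ 0 := by
  by_contra! h
  -- At `M = 0`, `P = eᵢ` the discriminant is `(ε/2)(1 - Aᵢ²)`; if all three vanished, `|A|²` would
  -- be `3`.
  have key : ∀ i, A i * A i = 1 := fun i => by
    have h1 := h (0, Pi.single i 1)
    rw [discriminant] at h1
    simp only [zero_add, map_smul, dotProduct_smul, smul_eq_mul] at h1
    have h2 := (mul_eq_zero.1 h1).resolve_left (by simpa using hε)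
    rw [← cross_anticomm A (Pi.single i 1), map_neg, cross_cross_self, hA] at h2
    simp at h2
    linarith
  simp only [dotProduct, key] at hA
  norm_num at hA

theorem dense_discriminant_ne_zero {ε : ℝ} (hε : ε ≠ 0) {A : Vec} (hA : A ⬝ᵥ A = 1) :
    Dense {z | discriminant ε A z ≠ 0} := by
  obtain ⟨w, hw⟩ := exists_discriminant_ne_zero hε hA
  intro z
  rw [mem_closure_iff_frequently]
  intro h
  simp only [Set.mem_ofPred_eq, not_not] at h
  have hc : ∀ c : ℝ, Filter.Tendsto (fun s : ℝ => z + (c * s) • w) (nhds 0) (nhds z) := fun c => by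
    have : Continuous fun s : ℝ => z + (c * s) • w := by fun_prop
    simpa using this.tendsto 0
  have h1 := ((hc 1).eventually h).and ((hc (-1)).eventually h)
  obtain ⟨s, hs, hs0⟩ := ((h1.filter_mono nhdsWithin_le_nhds).and
    (self_mem_nhdsWithin : {0}ᶜ ∈ nhdsWithin (0 : ℝ) {0}ᶜ)).exists
  have h2 := discriminant_parallelogram ε A z w s
  rw [one_mul, neg_one_mul] at hs
  rw [hs.1, hs.2, h.self_of_nhds] at h2
  have : s ≠ 0 := hs0
  simp [hw, this] at h2

theorem linearIndependent_hamField {ε : ℝ} {A : Vec} {z : Phase} (h : discriminant ε A z ≠ 0) :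
    LinearIndependent ℝ ![hamField (axisMomentum A) z, hamField (energy ε A) z] := by
  rw [LinearIndependent.pair_iff]
  intro s t hst
  have h2 := congrArg Prod.snd hst
  simp only [Prod.snd_add, Prod.smul_snd, hamField, (grad_axisMomentum A z).1,
    (grad_energy ε A z).1, Prod.snd_zero] at h2
  rw [discriminant] at h
  generalize z.1 + (ε / 2) • (z.2 ⨯₃ A) = G at *
  -- In the `P`-component `s P × A + t P × G = 0`, pairing with `A` isolates `t` and pairing with
  -- `G` isolates `s`, each multiplied by the discriminant up to sign.
  have h3 := congrArg (A ⬝ᵥ ·) h2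
  have h4 := congrArg (G ⬝ᵥ ·) h2
  have e1 : A ⬝ᵥ z.2 ⨯₃ G = - (z.2 ⬝ᵥ A ⨯₃ G) := by
    rw [triple_product_permutation, ← cross_anticomm, dotProduct_neg]
  have e2 : G ⬝ᵥ z.2 ⨯₃ A = z.2 ⬝ᵥ A ⨯₃ G := by rw [triple_product_permutation]
  simp only [dotProduct_add, dotProduct_smul, dot_cross_self, e1, e2, dotProduct_zero] at h3 h4
  exact ⟨by simpa [h] using h4, by simpa [h] using h3⟩

theorem isCompletelyIntegrable_topMap (α : ℝ) {ε : ℝ} (hε : ε ≠ 0) {A : Vec} (hA : A ⬝ᵥ A = 1) :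
    IsCompletelyIntegrable (topMap α ε A) (axisMomentum A) (energy ε A) where
  poisson := isPoissonMap_topMap α ε A
  smooth₁ := contDiff_axisMomentum A
  smooth₂ := contDiff_energy ε A
  integral₁ := axisMomentum_topMap α ε A
  integral₂ := energy_topMap α ε A
  involution := bracket_axisMomentum_energy ε A
  independent := by
    refine ⟨{z | discriminant ε A z ≠ 0}, isOpen_ne_fun (continuous_discriminant ε A)
      continuous_const, dense_discriminant_ne_zero hε hA, fun z hz => ⟨finrank_leafTangent ?_,
        linearIndependent_hamField hz⟩⟩
    intro hP
    exact hz (by rw [discriminant, hP, zero_dotProduct])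

/-! ### Small time steps -/

/-- An exact remainder: its denominator is at least `1`, so for `|δ| ≤ 1` the cofactor of `δ²` is
bounded by a continuous function of `M`, hence on balls. -/
theorem xi_expansion (α : ℝ) {A : Vec} (hA : A ⬝ᵥ A = 1) (δ : ℝ) (M : Vec) :
    xi α δ A M - δ • ((1 / α) • M + ((1 - α) / α) • (A ⨯₃ (A ⨯₃ M))) =
      (δ ^ 2 * ((1 - α) / α) * (1 + (δ * (A ⬝ᵥ M)) ^ 2 / 4)⁻¹) • ((A ⬝ᵥ M / 2) • (A ⨯₃ M) -
        (δ * ((A ⬝ᵥ M) ^ 2 / 4)) • (A ⨯₃ (A ⨯₃ M))) := by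
  rw [xi_eq_tilt, tilt_eq hA]
  have h : (A ⬝ᵥ δ • M) • A - δ • M = δ • (A ⨯₃ (A ⨯₃ M)) := by
    rw [cross_cross_self, hA, dotProduct_smul, smul_eq_mul]
    module
  rw [h, map_smul, dotProduct_smul, smul_eq_mul]
  generalize A ⨯₃ (A ⨯₃ M) = X
  generalize A ⨯₃ M = Y
  generalize A ⬝ᵥ M = m
  ext i
  simp only [Pi.add_apply, Pi.sub_apply, Pi.smul_apply, smul_eq_mul]
  have h1 : 0 < 4 + δ ^ 2 * m ^ 2 := by positivity
  field_simp
  ring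

theorem exists_xi_expansion_bound (α : ℝ) {A : Vec} (hA : A ⬝ᵥ A = 1) (R : ℝ) :
    ∃ C : ℝ, ∀ (δ : ℝ) (M : Vec), |δ| ≤ 1 → ‖M‖ ≤ R →
      ‖xi α δ A M - δ • ((1 / α) • M + ((1 - α) / α) • (A ⨯₃ (A ⨯₃ M)))‖ ≤ C * δ ^ 2 := by
  have hid : ContDiff ℝ 0 fun M : Vec => M := contDiff_id
  have hc : ContDiff ℝ 0 fun _ : Vec => A := contDiff_const
  have hY : Continuous fun M : Vec => A ⨯₃ M := (hc.vec_cross hid).continuous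
  have hX : Continuous fun M : Vec => A ⨯₃ (A ⨯₃ M) := (hc.vec_cross (hc.vec_cross hid)).continuous
  have hm : Continuous fun M : Vec => A ⬝ᵥ M := (hc.vec_dot hid).continuous
  obtain ⟨C, hC⟩ := (isCompact_closedBall (0 : Vec) R).exists_bound_of_continuousOn
    (f := fun M => |(1 - α) / α| * (‖(A ⬝ᵥ M / 2) • (A ⨯₃ M)‖ +
      ‖((A ⬝ᵥ M) ^ 2 / 4) • (A ⨯₃ (A ⨯₃ M))‖)) (by fun_prop)
  refine ⟨C, fun δ M hδ hM => ?_⟩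
  rw [xi_expansion α hA, norm_smul, Real.norm_eq_abs, abs_mul, abs_mul, abs_of_nonneg (sq_nonneg δ)]
  have h1 : |(1 + (δ * (A ⬝ᵥ M)) ^ 2 / 4)⁻¹| ≤ 1 := by
    rw [abs_of_nonneg (by positivity)]
    exact inv_le_one_of_one_le₀ (by linarith [sq_nonneg (δ * (A ⬝ᵥ M))])
  have h2 : ‖(A ⬝ᵥ M / 2) • (A ⨯₃ M) - (δ * ((A ⬝ᵥ M) ^ 2 / 4)) • (A ⨯₃ (A ⨯₃ M))‖ ≤
      ‖(A ⬝ᵥ M / 2) • (A ⨯₃ M)‖ + ‖((A ⬝ᵥ M) ^ 2 / 4) • (A ⨯₃ (A ⨯₃ M))‖ := by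
    refine (norm_sub_le _ _).trans (add_le_add_right ?_ _)
    rw [mul_smul, norm_smul, Real.norm_eq_abs]
    exact mul_le_of_le_one_left (norm_nonneg _) hδ
  have h3 := (le_abs_self _).trans (hC M (by simpa using hM))
  calc _ ≤ δ ^ 2 * |(1 - α) / α| * 1 * (‖(A ⬝ᵥ M / 2) • (A ⨯₃ M)‖ +
        ‖((A ⬝ᵥ M) ^ 2 / 4) • (A ⨯₃ (A ⨯₃ M))‖) := by gcongr
    _ = δ ^ 2 * (|(1 - α) / α| * (‖(A ⬝ᵥ M / 2) • (A ⨯₃ M)‖ +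
        ‖((A ⬝ᵥ M) ^ 2 / 4) • (A ⨯₃ (A ⨯₃ M))‖)) := by ring
    _ ≤ δ ^ 2 * C := by gcongr
    _ = C * δ ^ 2 := mul_comm _ _

end DiscreteTop

end

theorem theorem5p6 (α ε : ℝ) (hα : α ≠ 0) (hε : ε ≠ 0) (A : Vec) (hA : A ⬝ᵥ A = 1) :
    -- the momentum `d'_W Λ(P, W)` exists and is unique wherever `tr W > 0`
    (∀ (P : Vec) (W : SU2), 0 < tr W → ∃! M : Vec, HasLieDeriv (lagr α ε A P) W M) ∧
    -- the Euler–Lagrange equations are equivalent to the system, on every time interval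
    (∀ (p : Vec) (k₀ k₁ : ℤ) (_ : k₀ ≤ k₁) (g W : ℤ → SU2) (M P : ℤ → Vec),
      (∀ k, k₀ ≤ k → k < k₁ → g (k + 1) = g k * W k) →
      ((P k₀ = conj (g k₀) p ∧
        (∀ k, k₀ ≤ k → k < k₁ →
          P (k + 1) = conj (g (k + 1)) p ∧ 0 < tr (W k) ∧
            HasLieDeriv (lagr α ε A (P k)) (W k) (M (k + 1))) ∧
        (∀ k, k₀ < k → k < k₁ →
          EulerLagrange (discLagr α ε A p) (g (k - 1)) (g k) (g (k + 1))))
      ↔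
       (P k₀ = conj (g k₀) p ∧
        (∀ k, k₀ ≤ k → k < k₁ →
          P (k + 1) = conj (W k) (P k) ∧ IsAngVel α ε A (M (k + 1)) (W k)) ∧
        (∀ k, k₀ < k → k < k₁ →
          M (k + 1) = conj (W k) (M k + ε • (P k ⨯₃ A)))))) ∧
    -- `W` is determined by `M`, with the explicit reconstruction
    (∀ M : Vec, (∃ W, IsAngVel α ε A M W) ∧ ∀ W, IsAngVel α ε A M W →
      (W : Matrix (Fin 2) (Fin 2) ℂ) = ((tr W / 2 : ℝ) : ℂ) • (1 + hat (xi α ε A M)) ∧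
      tr W = 2 / √(1 + xi α ε A M ⬝ᵥ xi α ε A M / 4)) ∧
    -- the expansion for small time steps, uniformly on bounded sets of momenta
    (∀ R : ℝ, ∃ C : ℝ, ∀ (δ : ℝ) (M : Vec), |δ| ≤ 1 → ‖M‖ ≤ R →
      ‖xi α δ A M - δ • ((1 / α) • M + ((1 - α) / α) • (A ⨯₃ (A ⨯₃ M)))‖ ≤ C * δ ^ 2) ∧
    -- the system defines a map, which is Poisson and completely integrable
    ∃ Φ : Phase → Phase, (∀ z z', Step α ε A z z' ↔ z' = Φ z) ∧
      IsCompletelyIntegrable Φ (axisMomentum A) (energy ε A) := by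
  refine ⟨fun P W hW => ⟨_, hasLieDeriv_lagr α ε hA P hW, fun M hM =>
      hM.unique (hasLieDeriv_lagr α ε hA P hW)⟩,
    fun p k₀ k₁ _ g W M P hg => eulerLagrange_system_iff hα hε hA p hg,
    fun M => ⟨⟨ofVec (xi α ε A M), tr_ofVec_pos _, velocity_ofVec _⟩, fun W hW =>
      ⟨coe_eq_of_velocity hW.1 hW.2, tr_eq_of_velocity hW.1 hW.2⟩⟩,
    exists_xi_expansion_bound α hA,
    topMap α ε A, step_iff hα hε hA, isCompletelyIntegrable_topMap α hε hA⟩
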